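/- Let $l\ge 2$ and let $G=SO_o(1,l)$ be the identity component of the group $SO(1,l)$ of real $(l+1)\times(l+1)$ matrices of determinant one preserving the form $x_0y_0-x_1y_1-\dots-x_ly_l$. Let $K=\{1\}\times SO(l)\subset G$ be the standard maximal compact subgroup, let $\mathfrak g$ be the Lie algebra of $G$, let $\mathfrak a=\mathbb R H_0\subset\mathfrak g$, where $H_0$ has the entries $1$ at the positions $(0,l)$ and $(l,0)$ and zeros elsewhere, put $A=\exp\mathfrak a$ and let $M=Z_K(A)$ be the centralizer of $A$ in $K$. Let $\mathfrak n=\{X\in\mathfrak g:[H_0,X]=X\}$ be the root space of the positive root. Let $(\pi,V)$ be an irreducible (strongly continuous) unitary representation of $G$ on a complex Hilbert space which is spherical, and let $\varphi\in V$ be a nonzero $K$-fixed vector. For a subgroup $S$ let $V^S$ be the space of $S$-fixed vectors; for a smooth vector $v$ let $X v=\frac{d}{dt}\big|_{t=0}\pi(\exp tX)v$ $(X\in\mathfrak g)$, and let $U(\mathfrak a)v$ be the complex span of the vectors $Y_1\cdots Y_nv$ with $n\ge 0$ and $Y_i\in\mathfrak a$. Then $\varphi$ is a smooth vector, and the following hold.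 1. If $l>2$, then $A$ acts on $V^M$ (that is, $V^M$ is $\pi(A)$-invariant) with cyclic vector $\varphi$: the linear span of $\pi(A)\varphi$ is contained in $V^M$ and dense in it, and likewise $U(\mathfrak a)\varphi$ is contained in $V^M$ and dense in it. 2. If $l=2$, then $V^M=V$, and for every nonzero $X\in\mathfrak n$ (so that $\mathfrak n=\mathbb R X$) the sum of $U(\mathfrak a)\varphi$ and $U(\mathfrak a)X\varphi$ is direct, and $U(\mathfrak a)\varphi\oplus U(\mathfrak a)X\varphi$ is dense in $V^M=V$. -/

import Mathlib

noncomputable section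

namespace HypRep

open scoped Matrix
open Set

/-- The Gram matrix `diag(1, -1, …, -1)` of the form `x₀y₀ - x₁y₁ - ⋯ - x_l y_l` on `ℝ^{l+1}`. -/
def gram (l : ℕ) : Matrix (Fin (l + 1)) (Fin (l + 1)) ℝ :=
  Matrix.diagonal fun i => if i = 0 then 1 else -1

theorem gram_mul_gram (l : ℕ) : gram l * gram l = 1 := by
  rw [gram, Matrix.diagonal_mul_diagonal, ← Matrix.diagonal_one]
  congr 1
  funext i
  split_ifs <;> norm_num

/-- The group `SO(1,l)` of real matrices of determinant one preserving the form. -/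
def SO (l : ℕ) : Subgroup (Matrix.SpecialLinearGroup (Fin (l + 1)) ℝ) where
  carrier := {g | (g : Matrix (Fin (l + 1)) (Fin (l + 1)) ℝ)ᵀ * gram l * g = gram l}
  one_mem' := by simp
  mul_mem' := by
    intro a b ha hb
    simp only [Set.mem_ofPred_eq] at *
    rw [Matrix.SpecialLinearGroup.coe_mul, Matrix.transpose_mul]
    calc _ = (b : Matrix (Fin (l + 1)) (Fin (l + 1)) ℝ)ᵀ *
          ((a : Matrix (Fin (l + 1)) (Fin (l + 1)) ℝ)ᵀ * gram l * a) * b := by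
            simp only [Matrix.mul_assoc]
      _ = _ := by rw [ha, hb]
  inv_mem' := by
    intro a ha
    simp only [Set.mem_ofPred_eq] at *
    have h1 : (a : Matrix (Fin (l + 1)) (Fin (l + 1)) ℝ) * (a⁻¹ : Matrix.SpecialLinearGroup _ ℝ) = 1 := by
      rw [← Matrix.SpecialLinearGroup.coe_mul, mul_inv_cancel, Matrix.SpecialLinearGroup.coe_one]
    have h2 : ((a⁻¹ : Matrix.SpecialLinearGroup (Fin (l + 1)) ℝ) :
        Matrix (Fin (l + 1)) (Fin (l + 1)) ℝ)ᵀ * (a : Matrix (Fin (l + 1)) (Fin (l + 1)) ℝ)ᵀ = 1 := by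
      rw [← Matrix.transpose_mul, h1, Matrix.transpose_one]
    generalize ((a⁻¹ : Matrix.SpecialLinearGroup (Fin (l + 1)) ℝ) :
        Matrix (Fin (l + 1)) (Fin (l + 1)) ℝ) = b at *
    calc bᵀ * gram l * b
        = bᵀ * ((a : Matrix (Fin (l + 1)) (Fin (l + 1)) ℝ)ᵀ * gram l * a) * b := by rw [ha]
      _ = (bᵀ * (a : Matrix (Fin (l + 1)) (Fin (l + 1)) ℝ)ᵀ) * gram l *
            ((a : Matrix (Fin (l + 1)) (Fin (l + 1)) ℝ) * b) := by
            simp only [Matrix.mul_assoc]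
      _ = gram l := by rw [h1, h2, Matrix.one_mul, Matrix.mul_one]

/-- The group `G = SO_o(1,l)`: the connected component of the identity in `SO(1,l)`. -/
abbrev G (l : ℕ) : Type := Subgroup.connectedComponentOfOne (SO l)

/-- The matrix of an element of `G`. -/
def G.mat {l : ℕ} (g : G l) : Matrix (Fin (l + 1)) (Fin (l + 1)) ℝ := g.1.1.1

theorem G.mat_one {l : ℕ} : (1 : G l).mat = 1 := rfl

theorem G.mat_mul {l : ℕ} (g h : G l) : (g * h).mat = g.mat * h.mat := rfl

/-- The maximal compact subgroup `K = {1} × SO(l)` of `G`. Since the elements of `G` preserve the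
form and have determinant one, the elements fixing the first basis vector `e₀` are exactly the
block matrices `diag(1, R)` with `R ∈ SO(l)`. -/
def K (l : ℕ) : Subgroup (G l) where
  carrier := {k | k.mat *ᵥ Pi.single 0 1 = Pi.single 0 1}
  one_mem' := by
    simp only [Set.mem_ofPred_eq]
    rw [G.mat_one, Matrix.one_mulVec]
  mul_mem' := by
    intro a b ha hb
    simp only [Set.mem_ofPred_eq] at *
    rw [G.mat_mul, ← Matrix.mulVec_mulVec, hb, ha]
  inv_mem' := by
    intro a ha
    simp only [Set.mem_ofPred_eq] at *
    have h : (a⁻¹).mat * a.mat = 1 := by rw [← G.mat_mul, inv_mul_cancel, G.mat_one]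
    conv_lhs => rw [← ha]
    rw [Matrix.mulVec_mulVec, h, Matrix.one_mulVec]

/-- The Lie algebra `𝔤 = 𝔰𝔬(1,l)`: the matrices `X` with `Xᵀ J = J (-X)`, `J` the Gram matrix. -/
abbrev 𝔤 (l : ℕ) : Submodule ℝ (Matrix (Fin (l + 1)) (Fin (l + 1)) ℝ) :=
  skewAdjointMatricesSubmodule (gram l)

theorem mem_𝔤 {l : ℕ} (X : Matrix (Fin (l + 1)) (Fin (l + 1)) ℝ) :
    X ∈ 𝔤 l ↔ Xᵀ * gram l = gram l * (-X) := by
  rw [mem_skewAdjointMatricesSubmodule]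
  rfl

theorem exp_preserves {l : ℕ} (X : 𝔤 l) :
    (NormedSpace.exp X.1)ᵀ * gram l * NormedSpace.exp X.1 = gram l := by
  have hJ := gram_mul_gram l
  have hX : X.1ᵀ * gram l = gram l * (-X.1) := (mem_𝔤 X.1).1 X.2
  have hinv : (gram l)⁻¹ = gram l := Matrix.inv_eq_left_inv hJ
  have hu : IsUnit (gram l) := ⟨⟨gram l, gram l, hJ, hJ⟩, rfl⟩
  have h1 : X.1ᵀ = gram l * (-X.1) * (gram l)⁻¹ := by
    rw [hinv, ← hX, Matrix.mul_assoc, hJ, Matrix.mul_one]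
  have h2 : NormedSpace.exp (-X.1) * NormedSpace.exp X.1 = 1 := by
    rw [← Matrix.exp_add_of_commute _ _ (Commute.neg_left (Commute.refl X.1)), neg_add_cancel,
      NormedSpace.exp_zero]
  rw [← Matrix.exp_transpose, h1, Matrix.exp_conj _ _ hu, hinv]
  calc gram l * NormedSpace.exp (-X.1) * gram l * gram l * NormedSpace.exp X.1
      = gram l * (NormedSpace.exp (-X.1) * ((gram l * gram l) * NormedSpace.exp X.1)) := by
        simp only [Matrix.mul_assoc]
    _ = gram l := by rw [hJ, Matrix.one_mul, h2, Matrix.mul_one]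

theorem det_exp_eq_one {l : ℕ} (X : 𝔤 l) : (NormedSpace.exp X.1).det = 1 := by
  have hJ := gram_mul_gram l
  have hdJ : (gram l).det ≠ 0 := by
    intro h
    have := congrArg Matrix.det hJ
    rw [Matrix.det_mul, h] at this
    simp at this
  let Y : 𝔤 l := (2⁻¹ : ℝ) • X
  have hY : X.1 = 2 • Y.1 := by
    change X.1 = 2 • ((2⁻¹ : ℝ) • X.1)
    rw [two_nsmul, ← add_smul]
    norm_num
  have h := congrArg Matrix.det (exp_preserves Y)
  rw [Matrix.det_mul, Matrix.det_mul, Matrix.det_transpose] at h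
  have h' : (NormedSpace.exp Y.1).det ^ 2 = 1 := by
    apply mul_right_cancel₀ hdJ
    linear_combination h
  rw [hY, Matrix.exp_nsmul, Matrix.det_pow, h']

/-- The exponential of an element of the Lie algebra, as an element of `SO(1,l)`. -/
def expSO {l : ℕ} (X : 𝔤 l) : SO l :=
  ⟨⟨NormedSpace.exp X.1, det_exp_eq_one X⟩, exp_preserves X⟩

theorem continuous_expSO_smul {l : ℕ} (X : 𝔤 l) : Continuous fun t : ℝ => expSO (t • X) := by
  refine Continuous.subtype_mk (Continuous.subtype_mk ?_ _) _
  open scoped Matrix.Norms.Operator in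
  have h : Continuous (NormedSpace.exp : Matrix (Fin (l + 1)) (Fin (l + 1)) ℝ → _) :=
    NormedSpace.exp_continuous
  exact h.comp (continuous_id.smul continuous_const)

theorem expSO_mem {l : ℕ} (X : 𝔤 l) : expSO X ∈ Subgroup.connectedComponentOfOne (SO l) := by
  have h0 : expSO ((0 : ℝ) • X) = 1 := by
    apply Subtype.ext
    apply Subtype.ext
    change NormedSpace.exp ((0 : ℝ) • X.1) = 1
    rw [zero_smul, NormedSpace.exp_zero]
  have hc : IsPreconnected (range fun t : ℝ => expSO (t • X)) :=
    isPreconnected_range (continuous_expSO_smul X)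
  exact hc.subset_connectedComponent (x := 1) ⟨0, h0⟩ ⟨1, by simp⟩

/-- The exponential map `exp : 𝔤 → G`. -/
def expG {l : ℕ} (X : 𝔤 l) : G l := ⟨expSO X, expSO_mem X⟩

/-- The generator `H₀` of `𝔞`: its entries at `(0,l)` and `(l,0)` are one, the others vanish
(for `l = 0`, it is zero). -/
def H₀ (l : ℕ) : 𝔤 l :=
  ⟨Matrix.of fun i j =>
      if (i = 0 ∧ j = Fin.last l ∨ i = Fin.last l ∧ j = 0) ∧ i ≠ j then 1 else 0, by
    rw [mem_𝔤]
    ext i j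
    simp only [gram, Matrix.mul_diagonal, Matrix.diagonal_mul, Matrix.transpose_apply,
      Matrix.of_apply, Matrix.neg_apply]
    by_cases hi : i = 0 <;> by_cases hj : j = 0 <;> by_cases hi' : i = Fin.last l <;>
      by_cases hj' : j = Fin.last l <;> simp_all⟩

/-- The Lie algebra `𝔞 = ℝ H₀`. -/
def 𝔞 (l : ℕ) : Submodule ℝ (𝔤 l) := Submodule.span ℝ {H₀ l}

/-- The subgroup `A = exp 𝔞` (as a subset of `G`). -/
def A (l : ℕ) : Set (G l) := expG '' (𝔞 l : Set (𝔤 l))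

/-- The centralizer `M` of `A` in `K`. -/
def M (l : ℕ) : Subgroup (G l) := K l ⊓ Subgroup.centralizer (A l)

/-- The Lie algebra `𝔫`: the root space of the positive root `α`, which is normalized by
`α(H₀) = 1`; it consists of the `X ∈ 𝔤` with `[H₀, X] = X`. -/
def 𝔫 (l : ℕ) : Submodule ℝ (𝔤 l) where
  carrier := {X | (H₀ l).1 * X.1 - X.1 * (H₀ l).1 = X.1}
  zero_mem' := by simp
  add_mem' := by
    intro X Y hX hY
    simp only [Set.mem_ofPred_eq] at *
    rw [Submodule.coe_add, Matrix.mul_add, Matrix.add_mul, add_sub_add_comm, hX, hY]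
  smul_mem' := by
    intro c X hX
    simp only [Set.mem_ofPred_eq] at *
    rw [Submodule.coe_smul, Matrix.mul_smul, Matrix.smul_mul, ← smul_sub, hX]

/-- A unitary representation of a topological group: a strongly continuous homomorphism to the
group of unitary operators. -/
structure UnitaryRep (Γ : Type*) [Group Γ] [TopologicalSpace Γ] (V : Type*)
    [NormedAddCommGroup V] [InnerProductSpace ℂ V] where
  /-- the operators -/
  op : Γ →* (V ≃ₗᵢ[ℂ] V)
  continuous_op : ∀ v : V, Continuous fun x : Γ => op x v

namespace UnitaryRep

section General

variable {Γ : Type*} [Group Γ] [TopologicalSpace Γ] {V : Type*}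
    [NormedAddCommGroup V] [InnerProductSpace ℂ V]

/-- Irreducibility: the space is nonzero and its only closed invariant subspaces are the
trivial ones. -/
def IsIrreducible (π : UnitaryRep Γ V) : Prop :=
  Nontrivial V ∧ ∀ W : Submodule ℂ V, IsClosed (W : Set V) →
    (∀ x : Γ, ∀ w ∈ W, π.op x w ∈ W) → W = ⊥ ∨ W = ⊤

/-- The subspace `V^S` of the vectors fixed by the subgroup `S`. -/
def fixed (π : UnitaryRep Γ V) (S : Subgroup Γ) : Submodule ℂ V where
  carrier := {v | ∀ s ∈ S, π.op s v = v}
  zero_mem' := by simp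
  add_mem' := by
    intro v w hv hw s hs
    rw [map_add, hv s hs, hw s hs]
  smul_mem' := by
    intro c v hv s hs
    rw [map_smul, hv s hs]

end General

section Hyperbolic

variable {l : ℕ} {V : Type*} [NormedAddCommGroup V] [InnerProductSpace ℂ V]

open scoped ContDiff in
/-- Smooth vectors: the orbit map `x ↦ π(x) v` is `C^∞` on `G`. As `exp` is a local diffeomorphism
at `0` and the operators `π(x)` are bounded, it suffices to ask for this in the exponential
chart, i.e. on `X = ∑ tᵢ Xᵢ` for each finite family (in particular each basis) of `𝔤`. -/
def IsSmooth (π : UnitaryRep (G l) V) (v : V) : Prop :=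
  ∀ (n : ℕ) (X : Fin n → 𝔤 l),
    ContDiff ℝ ∞ fun t : Fin n → ℝ => π.op (expG (∑ i, t i • X i)) v

/-- The derived action `dπ(X) v = d/dt π(exp tX) v` at `t = 0`
(meaningful for smooth `v`, and `dπ(X) v` is then smooth again). -/
def dop (π : UnitaryRep (G l) V) (X : 𝔤 l) (v : V) : V :=
  deriv (fun t : ℝ => π.op (expG (t • X)) v) 0

/-- The space `U(𝔰) v` for a Lie algebra `𝔰 ⊆ 𝔤` and a smooth vector `v`: since the universal
enveloping algebra is spanned by the products `Y₁ ⋯ Y_n` (`n ≥ 0`) of elements of `𝔰`, it is the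
complex span of the vectors `dπ(Y₁) ⋯ dπ(Y_n) v`. -/
def envelope (π : UnitaryRep (G l) V) (𝔰 : Submodule ℝ (𝔤 l)) (v : V) : Submodule ℂ V :=
  Submodule.span ℂ {w | ∃ L : List (𝔤 l), (∀ Y ∈ L, Y ∈ 𝔰) ∧ w = L.foldr π.dop v}

end Hyperbolic

end UnitaryRep

end HypRep

end

/-! Hyperbolic space is `G/K`, the sheet `⟨v, v⟩ = 1` of the Lorentz form, so the orbit map of `φ`
is a function on it; extended by homogeneity of degree zero it becomes a bounded continuous function
`F = π.orbit φ` on the open forward cone, with `F (g v) = π(g) F(v)`. Consider the Laplace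
transforms `L_c(p) = ∫ exp(-⟨v, p⟩) exp(-c⟨v, v⟩) F(v) dv` over the cone. Since the form and
Lebesgue measure are invariant, `L_c(g p) = π(g) L_c(p)`. Hence `L_c(r e₀)` is `K`-fixed, and
because `K` is the small group of a Gelfand pair (`exists_smul_eq_of_fixed`), it is a multiple of
`φ`: thus `L_c(r g e₀) = C π(g)φ` with `C` depending only on `r` and `c`
(`exists_laplace_orbit_eq`). For some `r` and `c` the factor can be inverted
(`exists_op_eq_smul_laplace`). Laplace transforms are holomorphic in a tube, so `φ` is smooth and `t
↦ π(exp tH₀)φ` is real analytic. By analyticity, `U(𝔞)φ` and `π(A)φ` have the same orthogonal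
complement.

For density let `w` be orthogonal to `π(A)φ` and put `f(v) = ⟨w, F(v)⟩`. All transforms of `f`
vanish at the points of the cone in the plane of `e₀` and `e_l`, as these are multiples of points of
`A e₀`. In the variables `exp(-(v₀ - v_l))`, `exp(-(v₀ + v_l))`, `exp(-⟨v, v⟩)` this says that all
moments vanish, so `f = 0` as soon as `f` depends on `v₀`, `v_l`, `⟨v, v⟩` only
(`eq_zero_of_laplace_eq_zero`, by Stone–Weierstrass). If `l > 2` and `w` is `M`-fixed, `f` has this
property because `M` acts transitively on the level sets. Then `w` is orthogonal to the whole orbit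
of `φ`, and irreducibility gives `w = 0`.

If `l = 2`, `M` is trivial and the three quantities leave the sign of `v₁` free. The even part of
`f` under `v₁ ↦ -v₁` is treated as before; for odd `f` the function `v₁ f` is even. Its planar
transforms come from differentiating `L_c` transversally to the plane, along `exp(sX)`, which
produces the vectors `π(A)Xφ`. Parity also makes `π(A)φ` and `π(A)Xφ` orthogonal, so the sum is
direct. -/

noncomputable section

namespace HypRep

open scoped Matrix InnerProductSpace
open Set MeasureTheory

section Common

/-! ### The Lorentz form and the forward cone -/

/-- The Lorentz form `v₀w₀ - v₁w₁ - ⋯ - v_l w_l`. -/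
def lor {l : ℕ} (v w : Fin (l + 1) → ℝ) : ℝ := v ⬝ᵥ (gram l *ᵥ w)

/-- The first basis vector, the base point of hyperbolic space. -/
abbrev e₀ (l : ℕ) : Fin (l + 1) → ℝ := Pi.single 0 1

/-- The last basis vector. -/
abbrev eₗ (l : ℕ) : Fin (l + 1) → ℝ := Pi.single (Fin.last l) 1

/-- The open forward light cone. -/
def cone (l : ℕ) : Set (Fin (l + 1) → ℝ) := {v | 0 < v 0 ∧ 0 < lor v v}

variable {l : ℕ}

theorem lor_eq (v w : Fin (l + 1) → ℝ) :
    lor v w = v 0 * w 0 - ∑ i : Fin l, v i.succ * w i.succ := by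
  simp [lor, dotProduct, gram, Matrix.mulVec_diagonal, Fin.sum_univ_succ, Fin.succ_ne_zero]
  ring

theorem lor_eq_two_mul_sub (v w : Fin (l + 1) → ℝ) : lor v w = 2 * (v 0 * w 0) - v ⬝ᵥ w := by
  rw [lor_eq, dotProduct, Fin.sum_univ_succ]
  ring

theorem lor_comm (v w : Fin (l + 1) → ℝ) : lor v w = lor w v := by
  simp only [lor_eq, mul_comm]

theorem lor_smul_left (c : ℝ) (v w : Fin (l + 1) → ℝ) : lor (c • v) w = c * lor v w := by
  simp [lor]

theorem lor_smul_right (c : ℝ) (v w : Fin (l + 1) → ℝ) : lor v (c • w) = c * lor v w := by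
  rw [lor_comm, lor_smul_left, lor_comm]

theorem lor_add_right (v w w' : Fin (l + 1) → ℝ) : lor v (w + w') = lor v w + lor v w' := by
  simp [lor, Matrix.mulVec_add]

theorem lor_e₀ (v : Fin (l + 1) → ℝ) : lor v (e₀ l) = v 0 := by
  simp [lor_eq]

theorem lor_eₗ (hl : l ≠ 0) (v : Fin (l + 1) → ℝ) : lor v (eₗ l) = -v (Fin.last l) := by
  have : (0 : Fin (l + 1)) ≠ Fin.last l := by
    intro h; exact hl (by simpa using (congrArg Fin.val h).symm)
  rw [lor_eq_two_mul_sub]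
  simp [this]

theorem continuous_lor_self : Continuous fun v : Fin (l + 1) → ℝ => lor v v := by
  simp only [lor_eq]
  fun_prop

theorem continuous_lor_right (v : Fin (l + 1) → ℝ) : Continuous (lor v) := by
  unfold lor
  fun_prop

theorem isOpen_cone : IsOpen (cone l) :=
  (isOpen_lt continuous_const (continuous_apply 0)).inter
    (isOpen_lt continuous_const continuous_lor_self)

theorem measurableSet_cone : MeasurableSet (cone l) := isOpen_cone.measurableSet

theorem e₀_mem_cone : e₀ l ∈ cone l := by
  constructor
  · simp
  · rw [lor_e₀]; simp

theorem smul_mem_cone {v : Fin (l + 1) → ℝ} (hv : v ∈ cone l) {c : ℝ} (hc : 0 < c) :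
    c • v ∈ cone l := by
  refine ⟨mul_pos hc hv.1, ?_⟩
  rw [lor_smul_left, lor_smul_right]
  exact mul_pos hc (mul_pos hc hv.2)

/-- The sup norm of a cone vector is attained at the time coordinate; this turns lower bounds in
terms of `v 0` into the decay that makes Laplace integrals converge. -/
theorem norm_eq_of_mem_cone {v : Fin (l + 1) → ℝ} (hv : v ∈ cone l) : ‖v‖ = v 0 := by
  apply le_antisymm
  · rw [pi_norm_le_iff_of_nonneg hv.1.le]
    intro i
    rw [Real.norm_eq_abs]
    refine Fin.cases (by rw [abs_of_pos hv.1]) (fun j => ?_) i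
    apply abs_le_of_sq_le_sq _ hv.1.le
    have h := hv.2
    rw [lor_eq] at h
    have := Finset.single_le_sum (f := fun i : Fin l => v i.succ * v i.succ)
      (fun i _ => mul_self_nonneg _) (Finset.mem_univ j)
    nlinarith
  · exact (le_abs_self _).trans (norm_le_pi_norm v 0)

/-- Pairing of a cone vector with a vector of the cone: the reverse Cauchy–Schwarz inequality. -/
theorem exists_lor_ge {p : Fin (l + 1) → ℝ} (hp : p ∈ cone l) :
    ∃ ε > 0, ∀ v ∈ cone l, ε * v 0 ≤ lor p v := by
  have hq := hp.2
  rw [lor_eq] at hq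
  have hnn : 0 ≤ ∑ i : Fin l, p i.succ * p i.succ := Finset.sum_nonneg fun i _ => mul_self_nonneg _
  set P := √(∑ i : Fin l, p i.succ * p i.succ) with hP
  have hP2 : P ^ 2 = ∑ i : Fin l, p i.succ * p i.succ := Real.sq_sqrt hnn
  have hP0 : 0 ≤ P := Real.sqrt_nonneg _
  refine ⟨p 0 - P, ?_, fun v hv => ?_⟩
  · have := hp.1
    nlinarith
  · have hv2 := hv.2
    rw [lor_eq] at hv2 ⊢
    have hcs := Finset.sum_mul_sq_le_sq_mul_sq Finset.univ (fun i : Fin l => p i.succ)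
      (fun i : Fin l => v i.succ)
    simp only [sq] at hcs
    have : ∑ i : Fin l, p i.succ * v i.succ ≤ P * v 0 := by
      apply le_of_sq_le_sq _ (mul_nonneg hP0 hv.1.le)
      rw [mul_pow, hP2, sq]
      refine hcs.trans (mul_le_mul_of_nonneg_left ?_ hnn)
      nlinarith
    linarith

/-! ### The action of the group -/

theorem lor_mulVec_of_preserves {g : Matrix (Fin (l + 1)) (Fin (l + 1)) ℝ}
    (h : gᵀ * gram l * g = gram l) (v w : Fin (l + 1) → ℝ) :
    lor (g *ᵥ v) (g *ᵥ w) = lor v w := by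
  unfold lor
  rw [← Matrix.vecMul_transpose, ← Matrix.dotProduct_mulVec, Matrix.mulVec_mulVec,
    Matrix.mulVec_mulVec, h]

theorem lor_mulVec (g : G l) (v w : Fin (l + 1) → ℝ) :
    lor (g.mat *ᵥ v) (g.mat *ᵥ w) = lor v w :=
  lor_mulVec_of_preserves g.1.2 v w

theorem continuous_mat_SO :
    Continuous fun h : SO l => (h.1 : Matrix (Fin (l + 1)) (Fin (l + 1)) ℝ) :=
  Continuous.comp (f := fun h : SO l => h.1) (g := Subtype.val) continuous_subtype_val continuous_subtype_val

theorem G.ext_mat {g h : G l} (H : g.mat = h.mat) : g = h :=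
  Subtype.ext (Subtype.ext (Subtype.ext H))

theorem mat_inv_mulVec_mulVec (g : G l) (v : Fin (l + 1) → ℝ) :
    (g⁻¹).mat *ᵥ (g.mat *ᵥ v) = v := by
  rw [Matrix.mulVec_mulVec, ← G.mat_mul, inv_mul_cancel, G.mat_one, Matrix.one_mulVec]

theorem mat_mulVec_inv_mulVec (g : G l) (v : Fin (l + 1) → ℝ) :
    g.mat *ᵥ ((g⁻¹).mat *ᵥ v) = v := by
  rw [Matrix.mulVec_mulVec, ← G.mat_mul, mul_inv_cancel, G.mat_one, Matrix.one_mulVec]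

theorem det_mat (g : G l) : g.mat.det = 1 := g.1.1.2

/-- Connectedness enters here: on all of `SO(1,l)` the time coordinate of `h v` cannot vanish, since
`⟨hv, hv⟩ > 0`, so its sign is constant on the identity component. -/
theorem mulVec_mem_cone (g : G l) {v : Fin (l + 1) → ℝ} (hv : v ∈ cone l) :
    g.mat *ᵥ v ∈ cone l := by
  have hne : ∀ h : SO l, ((h.1 : Matrix (Fin (l + 1)) (Fin (l + 1)) ℝ) *ᵥ v) 0 ≠ 0 := by
    intro h h0
    have hpos := hv.2
    rw [← lor_mulVec_of_preserves h.2, lor_eq, h0] at hpos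
    have := Finset.sum_nonneg (s := Finset.univ) fun (i : Fin l) _ =>
      mul_self_nonneg (((h.1 : Matrix (Fin (l + 1)) (Fin (l + 1)) ℝ) *ᵥ v) i.succ)
    linarith
  have hc : Continuous fun h : SO l =>
      ((h.1 : Matrix (Fin (l + 1)) (Fin (l + 1)) ℝ) *ᵥ v) 0 :=
    (continuous_apply 0).comp (continuous_mat_SO.matrix_mulVec continuous_const)
  refine ⟨?_, by rw [lor_mulVec]; exact hv.2⟩
  by_contra hneg
  have hpre : IsPreconnected (connectedComponent (1 : SO l)) := isPreconnected_connectedComponent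
  obtain ⟨h, -, h0⟩ := hpre.intermediate_value g.2 (mem_connectedComponent (x := (1 : SO l)))
    hc.continuousOn (show (0 : ℝ) ∈ _ from ⟨not_lt.1 hneg, by simpa using hv.1.le⟩)
  exact hne h h0

theorem mem_K {k : G l} : k ∈ K l ↔ k.mat *ᵥ e₀ l = e₀ l := Iff.rfl

theorem inv_mul_mem_K {g h : G l} : h⁻¹ * g ∈ K l ↔ g.mat *ᵥ e₀ l = h.mat *ᵥ e₀ l := by
  rw [mem_K, G.mat_mul, ← Matrix.mulVec_mulVec]
  constructor
  · intro H
    conv_rhs => rw [← H]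
    rw [mat_mulVec_inv_mulVec]
  · intro H
    rw [H, mat_inv_mulVec_mulVec]

/-! ### Exponentials -/

theorem mat_expG (X : 𝔤 l) : (expG X).mat = NormedSpace.exp X.1 := rfl

open scoped Matrix.Norms.Operator in
/-- A solution of `c' = X c` is given by the exponential. -/
theorem exp_smul_mulVec {n : Type*} [Fintype n] [DecidableEq n] {X : Matrix n n ℝ}
    {c : ℝ → n → ℝ} (hc : ∀ t, HasDerivAt c (X *ᵥ c t) t) (t : ℝ) :
    NormedSpace.exp (t • X) *ᵥ c 0 = c t := by
  have hb : ∀ s, HasDerivAt (fun s : ℝ => NormedSpace.exp (s • (-X)) *ᵥ c s) 0 s := by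
    intro s
    have h1 := hasDerivAt_exp_smul_const (-X) s
    rw [hasDerivAt_pi]
    intro i
    have h2 : ∀ j, HasDerivAt (fun s : ℝ => NormedSpace.exp (s • (-X)) i j)
        ((NormedSpace.exp (s • (-X)) * -X) i j) s := by
      intro j
      exact (LinearMap.toContinuousLinearMap
        (Matrix.entryLinearMap ℝ ℝ i j)).hasFDerivAt.comp_hasDerivAt s h1
    have h3 := HasDerivAt.fun_sum (u := Finset.univ) fun j _ =>
      (h2 j).mul ((hasDerivAt_pi.1 (hc s)) j)
    convert! h3 using 1
    rw [Finset.sum_add_distrib]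
    change 0 = ((NormedSpace.exp (s • (-X)) * -X) *ᵥ c s) i
      + (NormedSpace.exp (s • (-X)) *ᵥ (X *ᵥ c s)) i
    rw [Matrix.mulVec_mulVec, Matrix.mul_neg, Matrix.neg_mulVec]
    simp
  have hconst := is_const_of_deriv_eq_zero (fun s => (hb s).differentiableAt)
    (fun s => (hb s).deriv) t 0
  simp only [zero_smul, NormedSpace.exp_zero, Matrix.one_mulVec] at hconst
  rw [← hconst, Matrix.mulVec_mulVec, ← Matrix.exp_add_of_commute]
  · simp
  · simp [Commute, SemiconjBy]

theorem exp_mulVec_of_mulVec_eq_zero {n : Type*} [Fintype n] [DecidableEq n] {X : Matrix n n ℝ}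
    {v : n → ℝ} (h : X *ᵥ v = 0) : NormedSpace.exp X *ᵥ v = v := by
  have := exp_smul_mulVec (X := X) (c := fun _ => v)
    (fun t => by rw [h]; exact hasDerivAt_const t v) 1
  simpa using this

/-! ### Boosts -/

/-- The one-parameter group `A`. -/
def boost (l : ℕ) (t : ℝ) : G l := expG (t • H₀ l)

theorem boost_mem (t : ℝ) : boost l t ∈ A l :=
  ⟨t • H₀ l, Submodule.smul_mem _ _ (Submodule.mem_span_singleton_self _), rfl⟩

theorem A_eq_range : A l = range (boost l) := by
  ext g
  constructor
  · rintro ⟨X, hX, rfl⟩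
    obtain ⟨t, rfl⟩ := Submodule.mem_span_singleton.1 hX
    exact ⟨t, rfl⟩
  · rintro ⟨t, rfl⟩
    exact boost_mem t

theorem expG_add_smul (X : 𝔤 l) (s t : ℝ) : expG ((s + t) • X) = expG (s • X) * expG (t • X) := by
  apply G.ext_mat
  rw [G.mat_mul, mat_expG, mat_expG, mat_expG, Submodule.coe_smul, Submodule.coe_smul,
    Submodule.coe_smul, add_smul, Matrix.exp_add_of_commute]
  exact (Commute.refl X.1).smul_left s |>.smul_right t

theorem expG_zero_smul (X : 𝔤 l) : expG ((0 : ℝ) • X) = 1 := by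
  apply G.ext_mat
  rw [mat_expG, zero_smul]
  exact NormedSpace.exp_zero

theorem boost_add (s t : ℝ) : boost l (s + t) = boost l s * boost l t := expG_add_smul _ _ _

theorem boost_zero : boost l 0 = 1 := expG_zero_smul _

theorem continuous_expG_smul (X : 𝔤 l) : Continuous fun t : ℝ => expG (t • X) :=
  (continuous_expSO_smul X).subtype_mk _

theorem zero_ne_last (hl : l ≠ 0) : (0 : Fin (l + 1)) ≠ Fin.last l := by
  intro h
  exact hl (by simpa using (congrArg Fin.val h).symm)

theorem H₀_mulVec (hl : l ≠ 0) (v : Fin (l + 1) → ℝ) :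
    (H₀ l).1 *ᵥ v = v (Fin.last l) • e₀ l + v 0 • eₗ l := by
  have h0 := zero_ne_last hl
  ext i
  simp only [H₀, Matrix.mulVec, dotProduct, Matrix.of_apply, Pi.add_apply, Pi.smul_apply,
    smul_eq_mul]
  by_cases hi : i = 0
  · subst hi
    rw [Finset.sum_eq_single (Fin.last l)]
    · simp [h0]
    · intro j _ hj
      simp [h0, hj]
    · simp
  · by_cases hi' : i = Fin.last l
    · subst hi'
      rw [Finset.sum_eq_single 0]
      · simp [h0, h0.symm]
      · intro j _ hj
        simp [h0.symm, hj]
      · simp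
    · simp [hi, hi']

theorem boost_mulVec (hl : l ≠ 0) (t : ℝ) (a b : ℝ) :
    (boost l t).mat *ᵥ (a • e₀ l + b • eₗ l) =
      (a * Real.cosh t + b * Real.sinh t) • e₀ l + (a * Real.sinh t + b * Real.cosh t) • eₗ l := by
  have h0 := zero_ne_last hl
  have := exp_smul_mulVec (X := (H₀ l).1) (c := fun t =>
    (a * Real.cosh t + b * Real.sinh t) • e₀ l + (a * Real.sinh t + b * Real.cosh t) • eₗ l)
    (fun t => by
      have h1 : HasDerivAt (fun t => a * Real.cosh t + b * Real.sinh t)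
          (a * Real.sinh t + b * Real.cosh t) t :=
        ((Real.hasDerivAt_cosh t).const_mul a).add ((Real.hasDerivAt_sinh t).const_mul b)
      have h2 : HasDerivAt (fun t => a * Real.sinh t + b * Real.cosh t)
          (a * Real.cosh t + b * Real.sinh t) t :=
        ((Real.hasDerivAt_sinh t).const_mul a).add ((Real.hasDerivAt_cosh t).const_mul b)
      have h3 := (h1.smul_const (e₀ l)).add (h2.smul_const (eₗ l))
      rw [H₀_mulVec hl]
      convert! h3 using 1
      simp [h0, h0.symm]) t
  simpa [boost, mat_expG] using this

theorem boost_mulVec_e₀ (hl : l ≠ 0) (t : ℝ) :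
    (boost l t).mat *ᵥ e₀ l = Real.cosh t • e₀ l + Real.sinh t • eₗ l := by
  simpa using boost_mulVec hl t 1 0

/-- An element of `G` fixing the vectors `e₀` and `e_l` centralizes `A`. -/
theorem mem_M_of_fixes (hl : l ≠ 0) {k : G l} (h0 : k.mat *ᵥ e₀ l = e₀ l)
    (h1 : k.mat *ᵥ eₗ l = eₗ l) : k ∈ M l := by
  refine ⟨h0, ?_⟩
  have hc : Commute k.mat (H₀ l).1 := by
    apply Matrix.mulVec_injective
    funext v
    have e1 : (k.mat *ᵥ v) 0 = v 0 := by
      rw [← lor_e₀ (k.mat *ᵥ v), ← lor_e₀ v, ← lor_mulVec k v, h0]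
    have e2 : (k.mat *ᵥ v) (Fin.last l) = v (Fin.last l) := by
      have := lor_mulVec k v (eₗ l)
      rw [h1, lor_eₗ hl, lor_eₗ hl] at this
      linarith
    rw [← Matrix.mulVec_mulVec, ← Matrix.mulVec_mulVec, H₀_mulVec hl, H₀_mulVec hl, e1, e2,
      Matrix.mulVec_add, Matrix.mulVec_smul, Matrix.mulVec_smul, h0, h1]
  change k ∈ Subgroup.centralizer (A l)
  rw [Subgroup.mem_centralizer_iff, A_eq_range]
  rintro _ ⟨t, rfl⟩
  apply G.ext_mat
  rw [G.mat_mul, G.mat_mul]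
  change NormedSpace.exp (t • (H₀ l).1) * k.mat = k.mat * NormedSpace.exp (t • (H₀ l).1)
  open scoped Matrix.Norms.Operator in
  exact ((hc.smul_right t).exp_right).symm.eq

/-! ### Rotations and transitivity -/

/-- The infinitesimal rotation in the plane of `u` and `w`. -/
def rotGen (u w : Fin (l + 1) → ℝ) : Matrix (Fin (l + 1)) (Fin (l + 1)) ℝ :=
  Matrix.vecMulVec w u - Matrix.vecMulVec u w

theorem rotGen_mem {u w : Fin (l + 1) → ℝ} (hu : u 0 = 0) (hw : w 0 = 0) : rotGen u w ∈ 𝔤 l := by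
  rw [mem_𝔤]
  ext i j
  by_cases hi : i = 0 <;> by_cases hj : j = 0 <;>
    simp [rotGen, gram, Matrix.mul_diagonal, Matrix.diagonal_mul, Matrix.vecMulVec_apply, hi, hj,
      hu, hw, mul_comm]

theorem rotGen_mulVec (u w x : Fin (l + 1) → ℝ) :
    rotGen u w *ᵥ x = (u ⬝ᵥ x) • w - (w ⬝ᵥ x) • u := by
  ext i
  simp only [rotGen, Matrix.mulVec, dotProduct, Matrix.sub_apply, Matrix.vecMulVec_apply,
    Pi.sub_apply, Pi.smul_apply, smul_eq_mul, Finset.sum_mul, sub_mul, Finset.sum_sub_distrib]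
  congr 1 <;> exact Finset.sum_congr rfl fun j _ => by ring

theorem exists_rotation {u w : Fin (l + 1) → ℝ} (hu : u 0 = 0) (hw : w 0 = 0) (huu : u ⬝ᵥ u = 1)
    (hww : w ⬝ᵥ w = 1) (huw : u ⬝ᵥ w = 0) (θ : ℝ) :
    ∃ k : G l, k.mat *ᵥ u = Real.cos θ • u + Real.sin θ • w ∧
      ∀ x, u ⬝ᵥ x = 0 → w ⬝ᵥ x = 0 → k.mat *ᵥ x = x := by
  refine ⟨expG (θ • ⟨rotGen u w, rotGen_mem hu hw⟩), ?_, fun x hx hx' => ?_⟩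
  · have := exp_smul_mulVec (X := rotGen u w) (c := fun t => Real.cos t • u + Real.sin t • w)
      (fun t => by
        have h := ((Real.hasDerivAt_cos t).smul_const u).add
          ((Real.hasDerivAt_sin t).smul_const w)
        convert! h using 1
        rw [rotGen_mulVec]
        simp [huu, hww, huw, dotProduct_comm w u]
        abel) θ
    simpa [mat_expG] using this
  · rw [mat_expG]
    apply exp_mulVec_of_mulVec_eq_zero
    change (θ • rotGen u w) *ᵥ x = 0
    rw [Matrix.smul_mulVec, rotGen_mulVec, hx, hx']
    simp

theorem exists_cos_sin {a b : ℝ} (h : a ^ 2 + b ^ 2 = 1) : ∃ θ, Real.cos θ = a ∧ Real.sin θ = b := by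
  have hn : ‖(⟨a, b⟩ : ℂ)‖ = 1 := by
    rw [Complex.norm_def, Complex.normSq_mk, ← sq, ← sq, h, Real.sqrt_one]
  have h0 : (⟨a, b⟩ : ℂ) ≠ 0 := by
    intro h
    rw [h] at hn
    simp at hn
  exact ⟨Complex.arg ⟨a, b⟩, by rw [Complex.cos_arg h0, hn, div_one],
    by rw [Complex.sin_arg, hn, div_one]⟩

/-- Normalization of a nonzero vector. -/
theorem exists_normalized {n : Type*} [Fintype n] {t : n → ℝ} (ht : t ≠ 0) :
    ∃ r : ℝ, 0 < r ∧ (r⁻¹ • t) ⬝ᵥ (r⁻¹ • t) = 1 ∧ r ^ 2 = t ⬝ᵥ t := by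
  have hpos : 0 < t ⬝ᵥ t := by
    refine lt_of_le_of_ne (Finset.sum_nonneg fun i _ => mul_self_nonneg _) fun h => ht ?_
    exact dotProduct_self_eq_zero.1 h.symm
  have hr := Real.sqrt_pos.2 hpos
  have hr2 := Real.sq_sqrt hpos.le
  refine ⟨√(t ⬝ᵥ t), hr, ?_, hr2⟩
  rw [smul_dotProduct, dotProduct_smul, smul_eq_mul, smul_eq_mul]
  field_simp
  rw [hr2]

/-- Rotate in a plane containing `s` and `s'`. The two free coordinates `i`, `j` supply such a plane
when the vectors are parallel. -/
theorem exists_rotation_of_dotProduct_eq {F : Set (Fin (l + 1))} (h0 : 0 ∈ F)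
    {i j : Fin (l + 1)} (hi : i ∉ F) (hj : j ∉ F) (hij : i ≠ j) {s s' : Fin (l + 1) → ℝ}
    (hs : ∀ k ∈ F, s k = 0) (hs' : ∀ k ∈ F, s' k = 0) (hss : s ⬝ᵥ s = s' ⬝ᵥ s') :
    ∃ k : G l, k.mat *ᵥ s = s' ∧ ∀ x : Fin (l + 1) → ℝ, (∀ m ∉ F, x m = 0) → k.mat *ᵥ x = x := by
  by_cases hs0 : s = 0
  · refine ⟨1, ?_, fun x _ => by rw [G.mat_one, Matrix.one_mulVec]⟩
    rw [G.mat_one, Matrix.one_mulVec]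
    rw [hs0, zero_dotProduct] at hss
    rw [hs0, dotProduct_self_eq_zero.1 hss.symm]
  obtain ⟨r, hr, hu1, hr2⟩ := exists_normalized hs0
  obtain ⟨u, hu⟩ : ∃ u, u = r⁻¹ • s := ⟨_, rfl⟩
  rw [← hu] at hu1
  have hsu : s = r • u := by rw [hu, smul_smul, mul_inv_cancel₀ hr.ne', one_smul]
  have huF : ∀ k ∈ F, u k = 0 := fun k hk => by simp [hu, hs k hk]
  have key : ∃ w : Fin (l + 1) → ℝ, ∃ b : ℝ, (∀ k ∈ F, w k = 0) ∧ w ⬝ᵥ w = 1 ∧ u ⬝ᵥ w = 0 ∧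
      s' = (u ⬝ᵥ s') • u + b • w := by
    -- If `s'` is parallel to `u`, any unit vector orthogonal to `u` and supported off `F` completes
    -- the plane; otherwise Gram–Schmidt provides `w`.
    by_cases hw0 : s' - (u ⬝ᵥ s') • u = 0
    · obtain ⟨t, htF, ht0, htu⟩ : ∃ t : Fin (l + 1) → ℝ, (∀ k ∈ F, t k = 0) ∧ t ≠ 0 ∧
          u ⬝ᵥ t = 0 := by
        by_cases hz : u i = 0
        · refine ⟨Pi.single i 1, fun k hk => ?_, by simp, by simp [hz]⟩
          rw [Pi.single_eq_of_ne]
          rintro rfl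
          exact hi hk
        · refine ⟨u i • Pi.single j 1 - u j • Pi.single i 1, fun k hk => ?_, fun h => hz ?_, ?_⟩
          · have h1 : k ≠ i := by rintro rfl; exact hi hk
            have h2 : k ≠ j := by rintro rfl; exact hj hk
            simp [h1, h2]
          · simpa [hij.symm] using congrFun h j
          · simp [dotProduct_sub]
            ring
      obtain ⟨ρ, hρ, hw1, -⟩ := exists_normalized ht0
      refine ⟨ρ⁻¹ • t, 0, fun k hk => by simp [htF k hk], hw1, by simp [htu], ?_⟩
      rw [zero_smul, add_zero]
      exact sub_eq_zero.1 hw0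
    · obtain ⟨ρ, hρ, hw1, -⟩ := exists_normalized hw0
      refine ⟨ρ⁻¹ • (s' - (u ⬝ᵥ s') • u), ρ, fun k hk => by simp [hs' k hk, huF k hk], hw1, ?_, ?_⟩
      · simp [dotProduct_sub, hu1]
      · rw [smul_smul ρ, mul_inv_cancel₀ hρ.ne', one_smul]
        abel
  obtain ⟨w, b, hwF, hw1, huw, hs'w⟩ := key
  set a := u ⬝ᵥ s' with ha
  have hab : a ^ 2 + b ^ 2 = r ^ 2 := by
    rw [hr2, hss, hs'w]
    simp [hu1, hw1, huw, dotProduct_comm w u]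
    ring
  obtain ⟨θ, hc, hsn⟩ := exists_cos_sin (a := a / r) (b := b / r) (by
    rw [div_pow, div_pow, ← add_div, hab, div_self (pow_pos hr 2).ne'])
  obtain ⟨k, hk, hk'⟩ := exists_rotation (huF 0 h0) (hwF 0 h0) hu1 hw1 huw θ
  have hdot : ∀ y x : Fin (l + 1) → ℝ, (∀ m ∈ F, y m = 0) → (∀ m ∉ F, x m = 0) → y ⬝ᵥ x = 0 := by
    intro y x hy hx
    refine Finset.sum_eq_zero fun m _ => ?_
    by_cases hm : m ∈ F
    · rw [hy m hm, zero_mul]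
    · rw [hx m hm, mul_zero]
  refine ⟨k, ?_, fun x hx => hk' x (hdot u x huF hx) (hdot w x hwF hx)⟩
  rw [hsu, Matrix.mulVec_smul, hk, hc, hsn, hs'w, smul_add, smul_smul, smul_smul,
    mul_div_cancel₀ _ hr.ne',
    mul_div_cancel₀ _ hr.ne']

/-- Rotations fixing the coordinates in `F` act transitively on the vectors with given coordinates
in `F` and given norm, if there are two coordinates outside `F`. -/
theorem exists_rotation_of_eqOn {F : Set (Fin (l + 1))} (h0 : 0 ∈ F)
    {i j : Fin (l + 1)} (hi : i ∉ F) (hj : j ∉ F) (hij : i ≠ j) {v v' : Fin (l + 1) → ℝ}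
    (hF : ∀ k ∈ F, v k = v' k) (hq : lor v v = lor v' v') :
    ∃ k : G l, k.mat *ᵥ v = v' ∧ ∀ m ∈ F, k.mat *ᵥ Pi.single m 1 = Pi.single m 1 := by
  classical
  have hsplit : ∀ y : Fin (l + 1) → ℝ, y = F.indicator y + Fᶜ.indicator y := fun y =>
    (Set.indicator_self_add_compl F y).symm
  have hdot : ∀ y : Fin (l + 1) → ℝ,
      y ⬝ᵥ y = F.indicator y ⬝ᵥ F.indicator y + Fᶜ.indicator y ⬝ᵥ Fᶜ.indicator y := by
    intro y
    rw [dotProduct, dotProduct, dotProduct, ← Finset.sum_add_distrib]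
    refine Finset.sum_congr rfl fun m _ => ?_
    by_cases hm : m ∈ F <;> simp [hm]
  have hind : F.indicator v = F.indicator v' := by
    ext m
    by_cases hm : m ∈ F <;> simp [hm, hF]
  obtain ⟨k, hk, hfix⟩ := exists_rotation_of_dotProduct_eq h0 hi hj hij
    (s := Fᶜ.indicator v) (s' := Fᶜ.indicator v') (fun m hm => by simp [hm])
    (fun m hm => by simp [hm]) (by
      rw [lor_eq_two_mul_sub, lor_eq_two_mul_sub, hF 0 h0, hdot v, hdot v', hind] at hq
      linarith)
  refine ⟨k, ?_, fun m hm => hfix _ fun n hn => ?_⟩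
  · rw [hsplit v, Matrix.mulVec_add, hk, hfix (F.indicator v) (fun m hm => by simp [hm]), hind, ← hsplit]
  · rw [Pi.single_eq_of_ne]
    rintro rfl
    exact hn hm

theorem exists_mem_K (hl : 2 ≤ l) {v v' : Fin (l + 1) → ℝ} (h0 : v 0 = v' 0)
    (hq : lor v v = lor v' v') : ∃ k ∈ K l, k.mat *ᵥ v = v' := by
  obtain ⟨k, hk, hf⟩ := exists_rotation_of_eqOn (F := {0}) rfl
    (i := ⟨1, by omega⟩) (j := ⟨2, by omega⟩) (by simp [Fin.ext_iff]) (by simp [Fin.ext_iff])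
    (by simp) (by simpa using h0) hq
  exact ⟨k, hf 0 rfl, hk⟩

/-- This is where `l > 2` matters: freezing the coordinates `0` and `l` must leave two free ones.
For `l = 2` the sign of `v₁` is a further invariant. -/
theorem exists_mem_M (hl : 2 < l) {v v' : Fin (l + 1) → ℝ} (h0 : v 0 = v' 0)
    (h1 : v (Fin.last l) = v' (Fin.last l)) (hq : lor v v = lor v' v') :
    ∃ k ∈ M l, k.mat *ᵥ v = v' := by
  obtain ⟨k, hk, hf⟩ := exists_rotation_of_eqOn (F := {0, Fin.last l}) (by simp)
    (i := ⟨1, by omega⟩) (j := ⟨2, by omega⟩) (by simp [Fin.ext_iff]; omega)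
    (by simp [Fin.ext_iff]; omega) (by simp) (by simp [h0, h1]) hq
  exact ⟨k, mem_M_of_fixes (by omega) (hf 0 (by simp)) (hf _ (by simp)), hk⟩

theorem one_le_of_lor_eq_one {v : Fin (l + 1) → ℝ} (hv : v ∈ cone l) (h1 : lor v v = 1) :
    1 ≤ v 0 := by
  rw [lor_eq] at h1
  have := Finset.sum_nonneg (s := Finset.univ) fun (i : Fin l) _ => mul_self_nonneg (v i.succ)
  nlinarith [hv.1]

/-- Polar coordinates on hyperbolic space. -/
theorem exists_polar (hl : 2 ≤ l) {v : Fin (l + 1) → ℝ} (hv : v ∈ cone l) (h1 : lor v v = 1) :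
    ∃ k ∈ K l, v = (k * boost l (Real.arcosh (v 0))).mat *ᵥ e₀ l := by
  have hc := Real.cosh_arcosh (one_le_of_lor_eq_one hv h1)
  obtain ⟨k, hk, hkv⟩ := exists_mem_K hl (v := (boost l (Real.arcosh (v 0))).mat *ᵥ e₀ l) (v' := v)
    (by
      rw [boost_mulVec_e₀ (by omega), hc]
      simp [zero_ne_last (show l ≠ 0 by omega)])
    (by rw [lor_mulVec, h1, lor_e₀]; simp)
  exact ⟨k, hk, by rw [G.mat_mul, ← Matrix.mulVec_mulVec, hkv]⟩

theorem exists_mulVec_e₀ (hl : 2 ≤ l) {v : Fin (l + 1) → ℝ} (hv : v ∈ cone l) :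
    ∃ g : G l, g.mat *ᵥ e₀ l = (√(lor v v))⁻¹ • v := by
  have hr := Real.sqrt_pos.2 hv.2
  obtain ⟨k, -, hk⟩ := exists_polar hl (smul_mem_cone hv (inv_pos.2 hr)) (by
    rw [lor_smul_left, lor_smul_right, ← mul_assoc, ← mul_inv, Real.mul_self_sqrt hv.2.le,
      inv_mul_cancel₀ hv.2.ne'])
  exact ⟨_, hk.symm⟩

theorem lor_inv_mulVec (g : G l) (v w : Fin (l + 1) → ℝ) :
    lor ((g⁻¹).mat *ᵥ v) w = lor v (g.mat *ᵥ w) := by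
  rw [← lor_mulVec g, mat_mulVec_inv_mulVec]

/-- `g⁻¹ ∈ K g K` for every `g`. -/
theorem exists_inv_eq (hl : 2 ≤ l) (g : G l) : ∃ k ∈ K l, ∃ k' ∈ K l, g⁻¹ = k * g * k' := by
  obtain ⟨k, hk, h⟩ := exists_mem_K hl (v := g.mat *ᵥ e₀ l) (v' := (g⁻¹).mat *ᵥ e₀ l)
    (by rw [← lor_e₀ (g.mat *ᵥ e₀ l), ← lor_e₀ ((g⁻¹).mat *ᵥ e₀ l), lor_inv_mulVec, lor_comm])
    (by rw [lor_mulVec, lor_mulVec])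
  refine ⟨k, hk, (k * g)⁻¹ * g⁻¹, ?_, by group⟩
  rw [inv_mul_mem_K, G.mat_mul, ← Matrix.mulVec_mulVec, h]

namespace UnitaryRep

/-! ### One-dimensionality of the space of fixed vectors -/

/-- Schur's lemma for a family of bounded symmetric operators whose products are symmetric. -/
theorem exists_eq_smul_of_isSymmetric {ι E : Type*} [NormedAddCommGroup E] [InnerProductSpace ℂ E]
    [CompleteSpace E] [Nontrivial E] (T : ι → E →L[ℂ] E)
    (hs : ∀ x n m, ⟪T x n, m⟫_ℂ = ⟪n, T x m⟫_ℂ)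
    (hr : ∀ x y n, (⟪n, T x (T y n)⟫_ℂ).im = 0)
    (hirr : ∀ n w : E, w ≠ 0 → (∀ y, ⟪n, T y w⟫_ℂ = 0) → n = 0) (x : ι) :
    ∃ c : ℝ, T x = algebraMap ℝ _ c := by
  have hsa' : ∀ x, IsSelfAdjoint (T x) := fun x =>
    ContinuousLinearMap.isSelfAdjoint_iff_isSymmetric.2 (hs x)
  -- A product of self-adjoint operators with real quadratic form is self-adjoint, hence equal to
  -- the product in the other order.
  have hcomm : ∀ x y, Commute (T x) (T y) := by
    intro x y
    have hsym : IsSelfAdjoint (T x * T y) := by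
      rw [ContinuousLinearMap.isSelfAdjoint_iff_isSymmetric,
        LinearMap.isSymmetric_iff_inner_map_self_real]
      intro n
      change (starRingEnd ℂ) ⟪T x (T y n), n⟫_ℂ = ⟪T x (T y n), n⟫_ℂ
      rw [Complex.conj_eq_iff_im, ← inner_conj_symm, Complex.conj_im, neg_eq_zero]
      exact hr x y n
    have h := hsym.star_eq
    rw [star_mul, (hsa' x).star_eq, (hsa' y).star_eq] at h
    exact h.symm
  set T₀ := T x with hT
  have hsa : IsSelfAdjoint T₀ := hsa' x
  -- If `g(T₀)a ≠ 0`, then `f(T₀)b` is orthogonal to every `T y (g(T₀)a)`, because `f(T₀)` commutes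
  -- with `T y` and `fg = 0`; irreducibility then kills `f(T₀)b`.
  have hzero : ∀ f g : ℝ → ℝ, Continuous f → Continuous g → (∀ t, f t * g t = 0) →
      cfc f T₀ = 0 ∨ cfc g T₀ = 0 := by
    intro f g hf hg hfg
    by_contra! hne
    obtain ⟨a, ha⟩ : ∃ a, cfc g T₀ a ≠ 0 := by
      by_contra! h
      exact hne.2 (ContinuousLinearMap.ext h)
    obtain ⟨b, hb⟩ : ∃ b, cfc f T₀ b ≠ 0 := by
      by_contra! h
      exact hne.1 (ContinuousLinearMap.ext h)
    have hprod : cfc f T₀ * cfc g T₀ = 0 := by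
      rw [← cfc_mul f g T₀ hf.continuousOn hg.continuousOn]
      simp [hfg]
    have hfs : IsSelfAdjoint (cfc f T₀) := cfc_predicate f T₀
    refine hb (hirr _ (cfc g T₀ a) ha fun y => ?_)
    have hc : Commute (cfc f T₀) (T y) := (hcomm x y).cfc_real f
    rw [ContinuousLinearMap.isSelfAdjoint_iff_isSymmetric] at hfs
    have h1 := hfs b (T y (cfc g T₀ a))
    change ⟪cfc f T₀ b, _⟫_ℂ = ⟪b, cfc f T₀ (T y (cfc g T₀ a))⟫_ℂ at h1
    rw [h1]
    have h2 : cfc f T₀ (T y (cfc g T₀ a)) = T y ((cfc f T₀ * cfc g T₀) a) :=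
      congrArg (fun U : E →L[ℂ] E => U (cfc g T₀ a)) hc.eq
    rw [h2, hprod]
    simp
  obtain ⟨r, hr⟩ := ContinuousFunctionalCalculus.spectrum_nonempty (R := ℝ) T₀ hsa
  refine ⟨r, CFC.eq_algebraMap_of_spectrum_subset_singleton T₀ r (fun s hs => ?_) hsa⟩
  have hcase : ∀ r s, r ∈ spectrum ℝ T₀ → s ∈ spectrum ℝ T₀ → ¬ r < s := by
    intro r s hr hs hrs
    have hspec : ∀ f : ℝ → ℝ, Continuous f → cfc f T₀ = 0 → ∀ t ∈ spectrum ℝ T₀, f t = 0 := by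
      intro f hf h0 t ht
      have := cfc_map_spectrum f T₀ hsa hf.continuousOn
      have hmem : f t ∈ spectrum ℝ (cfc f T₀) := this ▸ ⟨t, ht, rfl⟩
      rw [h0, spectrum.zero_eq] at hmem
      exact hmem
    -- Two distinct spectral points are separated by the positive and negative parts of `t - (r +
    -- s)/2`, whose product is zero.
    rcases hzero (fun t => max 0 (t - (r + s) / 2)) (fun t => max 0 ((r + s) / 2 - t))
      (by fun_prop) (by fun_prop) (fun t => by
        rcases le_total t ((r + s) / 2) with h | h
        · simp [max_eq_left (sub_nonpos.2 h)]
        · simp [max_eq_left (sub_nonpos.2 h)]) with h | h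
    · have := hspec _ (by fun_prop) h s hs
      have h2 := le_max_right 0 (s - (r + s) / 2)
      linarith
    · have := hspec _ (by fun_prop) h r hr
      have h2 := le_max_right 0 ((r + s) / 2 - r)
      linarith
  exact le_antisymm (not_lt.1 (hcase r s hr hs)) (not_lt.1 (hcase s r hs hr))

section General

variable {Γ : Type*} [Group Γ] [TopologicalSpace Γ] {V : Type*}
    [NormedAddCommGroup V] [InnerProductSpace ℂ V] (π : UnitaryRep Γ V)

theorem op_mul_apply (x y : Γ) (v : V) : π.op (x * y) v = π.op x (π.op y v) := by
  rw [map_mul]; rfl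

theorem op_one_apply (v : V) : π.op 1 v = v := by
  rw [map_one]; rfl

theorem op_inv_op (x : Γ) (v : V) : π.op x⁻¹ (π.op x v) = v := by
  rw [← op_mul_apply, inv_mul_cancel, op_one_apply]

theorem inner_op_left (x : Γ) (v w : V) : ⟪π.op x v, w⟫_ℂ = ⟪v, π.op x⁻¹ w⟫_ℂ := by
  rw [← LinearIsometryEquiv.inner_map_map (π.op x⁻¹), op_inv_op]

theorem isClosed_fixed (S : Subgroup Γ) : IsClosed (π.fixed S : Set V) := by
  have : (π.fixed S : Set V) = ⋂ s ∈ S, {v | π.op s v = v} := by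
    ext v
    simp [fixed]
  rw [this]
  exact isClosed_biInter fun s _ => isClosed_eq (π.op s).continuous continuous_id

/-- The vectors whose whole orbit is orthogonal to `n` form a closed invariant subspace; it contains
`w ≠ 0`, so it is everything, including `n`. -/
theorem IsIrreducible.eq_zero_of_inner_eq_zero {π : UnitaryRep Γ V} (hπ : π.IsIrreducible)
    {n w : V} (hw : w ≠ 0) (h : ∀ x, ⟪n, π.op x w⟫_ℂ = 0) : n = 0 := by
  let Z : Submodule ℂ V :=
    { carrier := {v | ∀ x, ⟪n, π.op x v⟫_ℂ = 0}
      zero_mem' := by simp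
      add_mem' := by
        intro a b ha hb x
        rw [map_add, inner_add_right, ha x, hb x, add_zero]
      smul_mem' := by
        intro c a ha x
        rw [map_smul, inner_smul_right, ha x, mul_zero] }
  have hZ : IsClosed (Z : Set V) := by
    have : (Z : Set V) = ⋂ x, {v | ⟪n, π.op x v⟫_ℂ = 0} := by
      ext v
      simp [Z]
    rw [this]
    exact isClosed_iInter fun x => isClosed_eq
      (continuous_const.inner (π.op x).continuous) continuous_const
  rcases hπ.2 Z hZ (fun y v hv x => by rw [← op_mul_apply]; exact hv _) with h0 | h1
  · have : w ∈ Z := h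
    rw [h0] at this
    exact absurd this hw
  · have : n ∈ Z := h1 ▸ Submodule.mem_top
    have := this 1
    rwa [op_one_apply, inner_self_eq_zero] at this

/-- The closed convex hull of an orbit contains a fixed vector. -/
theorem exists_fixed_mem_closure_convexHull [CompleteSpace V] (S : Subgroup Γ) (v : V) :
    ∃ p ∈ π.fixed S, p ∈ closure (convexHull ℝ ((fun s => π.op s v) '' (S : Set Γ))) := by
  let _ : InnerProductSpace ℝ V := InnerProductSpace.complexToReal
  set O := (fun s => π.op s v) '' (S : Set Γ) with hO
  set C := closure (convexHull ℝ O) with hC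
  have hconv : Convex ℝ C := (convex_convexHull ℝ O).closure
  have hne : C.Nonempty :=
    ⟨π.op 1 v, subset_closure (subset_convexHull ℝ _ ⟨1, S.one_mem, rfl⟩)⟩
  have hinv : ∀ s ∈ S, ∀ x ∈ C, π.op s x ∈ C := by
    intro s hs x hx
    have h1 : (π.op s) '' O ⊆ O := by
      rintro _ ⟨_, ⟨t, ht, rfl⟩, rfl⟩
      exact ⟨s * t, S.mul_mem hs ht, op_mul_apply _ _ _ _⟩
    have h2 : (π.op s) '' (convexHull ℝ O) ⊆ convexHull ℝ O := by
      have := LinearMap.image_convexHull ((π.op s).toLinearEquiv.toLinearMap.restrictScalars ℝ) O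
      change (π.op s) '' (convexHull ℝ O) = convexHull ℝ ((π.op s) '' O) at this
      rw [this]
      exact convexHull_mono h1
    exact map_mem_closure (π.op s).continuous hx fun y hy => h2 ⟨y, hy, rfl⟩
  obtain ⟨p, hp, hmin⟩ := exists_norm_eq_iInf_of_complete_convex hne
    isClosed_closure.isComplete hconv (0 : V)
  rw [norm_eq_iInf_iff_real_inner_le_zero hconv hp] at hmin
  refine ⟨p, fun s hs => ?_, hp⟩
  -- The point `p` of least norm satisfies `Re⟨p, π(s)p⟩ ≥ ‖p‖²`; as `π(s)p` has the same norm, the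
  -- two vectors agree.
  have h := hmin _ (hinv s hs p hp)
  rw [zero_sub, inner_neg_left, inner_sub_right, real_inner_self_eq_norm_sq] at h
  have h2 := norm_sub_sq_real (π.op s p) p
  rw [LinearIsometryEquiv.norm_map, real_inner_comm] at h2
  have h3 : ‖π.op s p - p‖ ^ 2 ≤ 0 := by linarith
  exact sub_eq_zero.1 (norm_eq_zero.1 (pow_eq_zero_iff two_ne_zero |>.1
    (le_antisymm h3 (sq_nonneg _))))

variable (S : Subgroup Γ)

theorem inner_fixed_op_mul {s : Γ} (hs : s ∈ S) {n : V} (hn : n ∈ π.fixed S) (v : V) :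
    ⟪n, π.op s v⟫_ℂ = ⟪n, v⟫_ℂ := by
  rw [← inner_conj_symm, inner_op_left, hn _ (S.inv_mem hs), inner_conj_symm]

variable {π S} in
-- Gelfand's trick: matrix coefficients between fixed vectors do not see left and right factors from
-- `S`, so `π(g)` and `π(g)⁻¹` have the same ones.
theorem inner_op_comm_of_fixed
    (hS : ∀ g : Γ, ∃ k ∈ S, ∃ k' ∈ S, g⁻¹ = k * g * k')
    {n m : V} (hn : n ∈ π.fixed S) (hm : m ∈ π.fixed S) (g : Γ) :
    ⟪π.op g n, m⟫_ℂ = ⟪n, π.op g m⟫_ℂ := by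
  obtain ⟨k, hk, k', hk', h⟩ := hS g
  rw [inner_op_left, h, op_mul_apply, hm k' hk', op_mul_apply, inner_fixed_op_mul π S hk hn]

variable [CompleteSpace V]

instance : CompleteSpace (π.fixed S) := (π.isClosed_fixed S).completeSpace_coe

/-- The compression of an operator of the representation to the space of fixed vectors. -/
def compress (x : Γ) : π.fixed S →L[ℂ] π.fixed S :=
  (π.fixed S).orthogonalProjectionOnto ∘L
    ((π.op x).toContinuousLinearEquiv : V →L[ℂ] V) ∘L (π.fixed S).subtypeL

theorem inner_compress (x : Γ) (n m : π.fixed S) :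
    ⟪n, π.compress S x m⟫_ℂ = ⟪(n : V), π.op x m⟫_ℂ := by
  simp [compress]

variable {π S} (hS : ∀ g : Γ, ∃ k ∈ S, ∃ k' ∈ S, g⁻¹ = k * g * k')
include hS

theorem inner_compress_left (g : Γ) (n m : π.fixed S) :
    ⟪π.compress S g n, m⟫_ℂ = ⟪n, π.compress S g m⟫_ℂ := by
  rw [inner_compress, ← inner_conj_symm, inner_compress, inner_conj_symm]
  exact inner_op_comm_of_fixed hS n.2 m.2 g

/-- The projection of `π(y)n` to the fixed vectors lies in the closed convex hull of the vectors
`π(s)π(y)n`, which replaces averaging over Haar measure. So the number is a limit of convex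
combinations of `⟨n, π(xsy)n⟩`, each real by Gelfand's trick. -/
theorem im_inner_compress_compress (x y : Γ) (n : π.fixed S) :
    (⟪n, π.compress S x (π.compress S y n)⟫_ℂ).im = 0 := by
  rw [inner_compress]
  obtain ⟨p, hp, hpc⟩ := π.exists_fixed_mem_closure_convexHull S (π.op y n)
  have hlim : ∀ f : V →ₗ[ℝ] ℝ, Continuous f → ∀ c : ℝ,
      (∀ s ∈ S, f (π.op s (π.op y n)) = c) → f p = c := by
    intro f hf c h
    have hcl : IsClosed {u : V | f u = c} := isClosed_eq hf continuous_const
    have hcv : Convex ℝ {u : V | f u = c} := convex_hyperplane f.isLinear c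
    refine closure_minimal (convexHull_min ?_ hcv) hcl hpc
    rintro _ ⟨s, hs, rfl⟩
    exact h s hs
  have hpeq : ((π.compress S y n : π.fixed S) : V) = p := by
    have : ∀ m : π.fixed S, ⟪m, π.compress S y n⟫_ℂ = ⟪m, (⟨p, hp⟩ : π.fixed S)⟫_ℂ := by
      intro m
      rw [inner_compress]
      apply Complex.ext
      · exact (hlim (Complex.reLm ∘ₗ ((innerSL ℂ (m : V)).toLinearMap.restrictScalars ℝ))
          (Complex.continuous_re.comp (innerSL ℂ (m : V)).continuous) _ fun s hs =>
          congrArg Complex.re (inner_fixed_op_mul π S hs m.2 _)).symm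
      · exact (hlim (Complex.imLm ∘ₗ ((innerSL ℂ (m : V)).toLinearMap.restrictScalars ℝ))
          (Complex.continuous_im.comp (innerSL ℂ (m : V)).continuous) _ fun s hs =>
          congrArg Complex.im (inner_fixed_op_mul π S hs m.2 _)).symm
    exact congrArg Subtype.val (ext_inner_left ℂ this)
  rw [hpeq]
  exact hlim (Complex.imLm ∘ₗ ((innerSL ℂ (n : V)).toLinearMap.restrictScalars ℝ) ∘ₗ
      ((π.op x).toLinearEquiv.toLinearMap.restrictScalars ℝ))
    (Complex.continuous_im.comp ((innerSL ℂ (n : V)).continuous.comp (π.op x).continuous)) 0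
    fun s hs => by
      change (⟪(n : V), π.op x (π.op s (π.op y n))⟫_ℂ).im = 0
      rw [← op_mul_apply, ← op_mul_apply, ← Complex.conj_eq_iff_im, inner_conj_symm]
      exact inner_op_comm_of_fixed hS n.2 n.2 _
/-- In an irreducible representation, the space of fixed vectors of the smaller group of a Gelfand
pair is at most one-dimensional. -/
theorem exists_smul_eq_of_fixed (hπ : π.IsIrreducible) {φ : V} (hφ₀ : φ ≠ 0)
    (hφ : φ ∈ π.fixed S) {n : V} (hn : n ∈ π.fixed S) : ∃ c : ℂ, n = c • φ := by
  have hnt : Nontrivial (π.fixed S) := ⟨⟨⟨φ, hφ⟩, 0, fun h => hφ₀ (congrArg Subtype.val h)⟩⟩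
  have hφφ : ⟪φ, φ⟫_ℂ ≠ 0 := inner_self_ne_zero.2 hφ₀
  set c := ⟪φ, n⟫_ℂ / ⟪φ, φ⟫_ℂ with hc
  refine ⟨c, ?_⟩
  have hm : n - c • φ ∈ π.fixed S := Submodule.sub_mem _ hn (Submodule.smul_mem _ _ hφ)
  have horth : ⟪n - c • φ, φ⟫_ℂ = 0 := by
    rw [← inner_conj_symm, inner_sub_right, inner_smul_right, hc, div_mul_cancel₀ _ hφφ, sub_self,
      map_zero]
  rw [← sub_eq_zero]
  refine hπ.eq_zero_of_inner_eq_zero hφ₀ fun x => ?_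
  -- The compression of `π(x)` is a scalar, so the component of `n` orthogonal to `φ` is orthogonal
  -- to every `π(x)φ`.
  obtain ⟨r, hr⟩ := exists_eq_smul_of_isSymmetric (π.compress S) (inner_compress_left hS)
    (im_inner_compress_compress hS) (fun n w hw h => Subtype.ext
      (hπ.eq_zero_of_inner_eq_zero (w := (w : V)) (by simpa using hw) fun y => by
        rw [← inner_compress]; exact h y)) x
  have h1 := π.inner_compress S x ⟨_, hm⟩ ⟨φ, hφ⟩
  rw [← h1, hr]
  change ⟪n - c • φ, (r : ℂ) • φ⟫_ℂ = 0
  rw [inner_smul_right, horth, mul_zero]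

end General

end UnitaryRep

namespace UnitaryRep

/-! ### The orbit map on the forward cone -/

variable {V : Type*} [NormedAddCommGroup V] [InnerProductSpace ℂ V] (π : UnitaryRep (G l) V)

/-- The orbit map of a `K`-fixed vector, as a function on hyperbolic space, extended to the forward
cone as a homogeneous function of degree zero. -/
def orbit (φ : V) (v : Fin (l + 1) → ℝ) : V :=
  open Classical in
  if h : ∃ g : G l, g.mat *ᵥ e₀ l = (√(lor v v))⁻¹ • v then π.op h.choose φ else 0

theorem norm_orbit_le (φ : V) (v : Fin (l + 1) → ℝ) : ‖π.orbit φ v‖ ≤ ‖φ‖ := by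
  unfold orbit
  split_ifs
  · rw [LinearIsometryEquiv.norm_map]
  · simp

variable {π} {φ : V} (hφ : φ ∈ π.fixed (K l))
include hφ

theorem op_eq_op_of_mulVec_eq {g h : G l} (H : g.mat *ᵥ e₀ l = h.mat *ᵥ e₀ l) :
    π.op g φ = π.op h φ := by
  have := hφ _ (inv_mul_mem_K.2 H)
  rw [op_mul_apply] at this
  conv_rhs => rw [← this]
  rw [← op_mul_apply, mul_inv_cancel, op_one_apply]

theorem orbit_eq {g : G l} {v : Fin (l + 1) → ℝ} (h : g.mat *ᵥ e₀ l = (√(lor v v))⁻¹ • v) :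
    π.orbit φ v = π.op g φ := by
  have hex : ∃ g : G l, g.mat *ᵥ e₀ l = (√(lor v v))⁻¹ • v := ⟨g, h⟩
  rw [orbit, dif_pos hex]
  exact op_eq_op_of_mulVec_eq hφ (hex.choose_spec.trans h.symm)

theorem orbit_mulVec_e₀ (g : G l) : π.orbit φ (g.mat *ᵥ e₀ l) = π.op g φ := by
  apply orbit_eq hφ
  rw [lor_mulVec, lor_e₀]
  simp

theorem orbit_e₀ : π.orbit φ (e₀ l) = φ := by
  have := orbit_mulVec_e₀ hφ 1
  rwa [G.mat_one, Matrix.one_mulVec, op_one_apply] at this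

variable (hl : 2 ≤ l)
include hl

theorem orbit_mulVec (g : G l) {v : Fin (l + 1) → ℝ} (hv : v ∈ cone l) :
    π.orbit φ (g.mat *ᵥ v) = π.op g (π.orbit φ v) := by
  obtain ⟨h, hh⟩ := exists_mulVec_e₀ hl hv
  rw [orbit_eq hφ hh, ← op_mul_apply]
  apply orbit_eq hφ
  rw [G.mat_mul, ← Matrix.mulVec_mulVec, hh, Matrix.mulVec_smul, lor_mulVec]

/-- The coefficient is a function of hyperbolic distance: write `g⁻¹h` in polar form `k a k'`; the
boost parameter is the distance of `g e₀` and `h e₀`. -/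
theorem inner_op_op (g h : G l) : ⟪π.op g φ, π.op h φ⟫_ℂ =
    ⟪φ, π.op (boost l (Real.arcosh (lor (g.mat *ᵥ e₀ l) (h.mat *ᵥ e₀ l)))) φ⟫_ℂ := by
  have hc : (g⁻¹ * h).mat *ᵥ e₀ l ∈ cone l := mulVec_mem_cone _ e₀_mem_cone
  obtain ⟨k, hk, h1⟩ := exists_polar hl hc (by rw [lor_mulVec, lor_e₀]; simp)
  have h2 : ((g⁻¹ * h).mat *ᵥ e₀ l) 0 = lor (g.mat *ᵥ e₀ l) (h.mat *ᵥ e₀ l) := by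
    rw [← lor_e₀ ((g⁻¹ * h).mat *ᵥ e₀ l), G.mat_mul, ← Matrix.mulVec_mulVec, lor_inv_mulVec,
      lor_comm]
  rw [inner_op_left, ← op_mul_apply, op_eq_op_of_mulVec_eq hφ h1, op_mul_apply,
    inner_fixed_op_mul π (K l) hk hφ, h2]

omit hφ in
theorem one_le_lor_normalized {v w : Fin (l + 1) → ℝ} (hv : v ∈ cone l) (hw : w ∈ cone l) :
    1 ≤ lor ((√(lor v v))⁻¹ • v) ((√(lor w w))⁻¹ • w) := by
  obtain ⟨g, hg⟩ := exists_mulVec_e₀ hl hv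
  obtain ⟨h, hh⟩ := exists_mulVec_e₀ hl hw
  rw [← hg, ← hh, lor_comm, ← lor_inv_mulVec, lor_e₀, Matrix.mulVec_mulVec, ← G.mat_mul]
  exact one_le_of_lor_eq_one (mulVec_mem_cone _ e₀_mem_cone) (by rw [lor_mulVec, lor_e₀]; simp)

theorem inner_orbit_orbit {v w : Fin (l + 1) → ℝ} (hv : v ∈ cone l) (hw : w ∈ cone l) :
    ⟪π.orbit φ v, π.orbit φ w⟫_ℂ = ⟪φ, π.op (boost l (Real.arcosh
      (lor ((√(lor v v))⁻¹ • v) ((√(lor w w))⁻¹ • w)))) φ⟫_ℂ := by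
  obtain ⟨g, hg⟩ := exists_mulVec_e₀ hl hv
  obtain ⟨h, hh⟩ := exists_mulVec_e₀ hl hw
  rw [orbit_eq hφ hg, orbit_eq hφ hh, inner_op_op hφ hl, hg, hh]

/-- Expand `‖F(v) - F(w)‖²`: the inner product depends on the distance only, so continuity along
boosts suffices and no local section of `G → G/K` is needed. -/
theorem continuousOn_orbit : ContinuousOn (π.orbit φ) (cone l) := by
  intro v hv
  have hsq : ∀ w ∈ cone l, ‖π.orbit φ v - π.orbit φ w‖ ^ 2 = 2 * ‖φ‖ ^ 2 -
      2 * (⟪φ, π.op (boost l (Real.arcosh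
        (lor ((√(lor v v))⁻¹ • v) ((√(lor w w))⁻¹ • w)))) φ⟫_ℂ).re := by
    intro w hw
    have := norm_sub_sq (𝕜 := ℂ) (π.orbit φ v) (π.orbit φ w)
    rw [inner_orbit_orbit hφ hl hv hw] at this
    obtain ⟨g, hg⟩ := exists_mulVec_e₀ hl hv
    obtain ⟨h, hh⟩ := exists_mulVec_e₀ hl hw
    rw [this, orbit_eq hφ hg, orbit_eq hφ hh, LinearIsometryEquiv.norm_map,
      LinearIsometryEquiv.norm_map]
    simp only [RCLike.re_to_complex]
    ring
  have hvv : lor ((√(lor v v))⁻¹ • v) ((√(lor v v))⁻¹ • v) = 1 := by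
    obtain ⟨g, hg⟩ := exists_mulVec_e₀ hl hv
    rw [← hg, lor_mulVec, lor_e₀]
    simp
  have hcont : ContinuousOn (fun w => 2 * ‖φ‖ ^ 2 - 2 * (⟪φ, π.op (boost l (Real.arcosh
      (lor ((√(lor v v))⁻¹ • v) ((√(lor w w))⁻¹ • w)))) φ⟫_ℂ).re) (cone l) := by
    have h1 : ContinuousOn (fun w : Fin (l + 1) → ℝ =>
        lor ((√(lor v v))⁻¹ • v) ((√(lor w w))⁻¹ • w)) (cone l) := by
      have h2 : ContinuousOn (fun w : Fin (l + 1) → ℝ => (√(lor w w))⁻¹) (cone l) :=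
        (Real.continuous_sqrt.comp continuous_lor_self).continuousOn.inv₀
          fun w hw => (Real.sqrt_pos.2 hw.2).ne'
      simp only [lor_smul_right]
      exact h2.mul (continuous_lor_right _).continuousOn
    have h3 := Real.continuousOn_arcosh.comp h1 fun w hw => one_le_lor_normalized hl hv hw
    have h4 : Continuous fun t => π.op (boost l t) φ :=
      (π.continuous_op φ).comp (continuous_expG_smul _)
    exact continuousOn_const.sub (continuousOn_const.mul (Complex.continuous_re.comp_continuousOn
      (continuousOn_const.inner (h4.comp_continuousOn h3))))
  have hlim := hcont v hv
  rw [ContinuousWithinAt, hvv] at hlim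
  simp only [Real.arcosh_zero, boost_zero, op_one_apply] at hlim
  rw [inner_self_eq_norm_sq_to_K] at hlim
  have h0 : (2 * ‖φ‖ ^ 2 - 2 * (((‖φ‖ : ℂ)) ^ 2).re) = 0 := by
    rw [← Complex.ofReal_pow, Complex.ofReal_re, sub_self]
  have h0' : Filter.Tendsto (fun w => ‖π.orbit φ v - π.orbit φ w‖ ^ 2) (nhdsWithin v (cone l))
      (nhds 0) := by
    rw [← h0]
    exact hlim.congr' (Filter.eventuallyEq_of_mem self_mem_nhdsWithin fun w hw => (hsq w hw).symm)
  rw [ContinuousWithinAt, tendsto_iff_norm_sub_tendsto_zero]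
  have := h0'.sqrt
  simp only [Real.sqrt_zero, Real.sqrt_sq (norm_nonneg _)] at this
  simpa only [norm_sub_rev] using this

end UnitaryRep

/-! ### Laplace transforms on the forward cone -/

theorem integrable_exp_neg_mul_norm_mul_pow {ε : ℝ} (hε : 0 < ε) (k : ℕ) :
    Integrable fun v : Fin (l + 1) → ℝ => Real.exp (-(ε * ‖v‖)) * (1 + ‖v‖) ^ k := by
  have h1 : Integrable (fun v : Fin (l + 1) → ℝ => (1 + ‖v‖) ^ (-((l + 2 : ℕ) : ℝ))) :=
    integrable_one_add_norm (by simp)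
  -- The exponent `l + 2` exceeds the dimension `l + 1`; `C` comes from `x ^ m / m! ≤ exp x` at `x =
  -- ε(1 + ‖v‖)`.
  set m := k + (l + 2) with hm
  set C := m.factorial * Real.exp ε / ε ^ m with hC
  refine (h1.const_mul C).mono' (by fun_prop) (Filter.Eventually.of_forall fun v => ?_)
  have hx : 0 < 1 + ‖v‖ := by positivity
  have h2 := Real.pow_div_factorial_le_exp (ε * (1 + ‖v‖)) (by positivity) m
  rw [Real.norm_of_nonneg (by positivity), Real.rpow_neg hx.le, Real.rpow_natCast,
    ← div_eq_mul_inv, le_div_iff₀ (by positivity), mul_assoc, ← pow_add, ← hm, hC,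
    le_div_iff₀ (by positivity)]
  rw [div_le_iff₀ (by positivity), mul_pow] at h2
  have h3 : Real.exp (ε * (1 + ‖v‖)) = Real.exp ε * Real.exp (ε * ‖v‖) := by
    rw [← Real.exp_add]; ring_nf
  rw [h3] at h2
  calc Real.exp (-(ε * ‖v‖)) * (1 + ‖v‖) ^ m * ε ^ m
      = Real.exp (-(ε * ‖v‖)) * (ε ^ m * (1 + ‖v‖) ^ m) := by ring
    _ ≤ Real.exp (-(ε * ‖v‖)) * (Real.exp ε * Real.exp (ε * ‖v‖) * m.factorial) := by gcongr
    _ = m.factorial * Real.exp ε * (Real.exp (-(ε * ‖v‖)) * Real.exp (ε * ‖v‖)) := by ring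
    _ = m.factorial * Real.exp ε := by rw [← Real.exp_add]; simp

/-- The bilinear pairing with a real vector, as a complex linear functional. -/
def pairing (v : Fin (l + 1) → ℝ) : (Fin (l + 1) → ℂ) →L[ℂ] ℂ :=
  ∑ i, (v i : ℂ) • ContinuousLinearMap.proj (R := ℂ) (φ := fun _ : Fin (l + 1) => ℂ) i

theorem pairing_apply (v : Fin (l + 1) → ℝ) (ζ : Fin (l + 1) → ℂ) :
    pairing v ζ = ∑ i, (v i : ℂ) * ζ i := by
  simp [pairing]

theorem norm_pairing_le (v : Fin (l + 1) → ℝ) : ‖pairing v‖ ≤ (l + 1) * ‖v‖ := by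
  refine ContinuousLinearMap.opNorm_le_bound _ (by positivity) fun ζ => ?_
  rw [pairing_apply]
  refine (norm_sum_le _ _).trans ?_
  refine (Finset.sum_le_card_nsmul _ _ (‖v‖ * ‖ζ‖) fun i _ => ?_).trans (le_of_eq ?_)
  · rw [norm_mul, Complex.norm_real]
    exact mul_le_mul (norm_le_pi_norm v i) (norm_le_pi_norm ζ i) (norm_nonneg _) (norm_nonneg _)
  · simp
    ring

theorem continuous_pairing : Continuous (pairing : (Fin (l + 1) → ℝ) → _) := by
  unfold pairing
  fun_prop

/-- The tube of complex covectors with real part in the open dual cone. -/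
def tube (l : ℕ) : Set (Fin (l + 1) → ℂ) :=
  {ζ | ∃ ε > 0, ∀ v ∈ cone l, ε * ‖v‖ ≤ (pairing v ζ).re}

theorem tube_ball {ζ : Fin (l + 1) → ℂ} {ε : ℝ}
    (h : ∀ v ∈ cone l, ε * ‖v‖ ≤ (pairing v ζ).re) {η : Fin (l + 1) → ℂ}
    (hη : η ∈ Metric.ball ζ (ε / (2 * (l + 1)))) {v : Fin (l + 1) → ℝ} (hv : v ∈ cone l) :
    ε / 2 * ‖v‖ ≤ (pairing v η).re := by
  have h1 : ‖pairing v (η - ζ)‖ ≤ ε / 2 * ‖v‖ := by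
    refine ((pairing v).le_opNorm _).trans ?_
    rw [mem_ball_iff_norm] at hη
    calc ‖pairing v‖ * ‖η - ζ‖ ≤ ((l + 1) * ‖v‖) * (ε / (2 * (l + 1))) :=
          mul_le_mul (norm_pairing_le v) hη.le (norm_nonneg _) (by positivity)
      _ = ε / 2 * ‖v‖ := by field_simp
  have h2 := (abs_le.1 ((Complex.abs_re_le_norm _).trans h1)).1
  rw [map_sub, Complex.sub_re] at h2
  linarith [h v hv]

theorem isOpen_tube : IsOpen (tube l) := by
  rw [Metric.isOpen_iff]
  rintro ζ ⟨ε, hε, h⟩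
  exact ⟨ε / (2 * (l + 1)), by positivity,
    fun η hη => ⟨ε / 2, by positivity, fun v hv => tube_ball h hη hv⟩⟩

variable {W : Type*} [NormedAddCommGroup W] [NormedSpace ℂ W]

/-- Continuous functions of polynomial growth on the cone. -/
def PolyGrowth (F : (Fin (l + 1) → ℝ) → W) : Prop :=
  ContinuousOn F (cone l) ∧ ∃ C : ℝ, 0 ≤ C ∧ ∃ k : ℕ, ∀ v ∈ cone l, ‖F v‖ ≤ C * (1 + ‖v‖) ^ k

/-- The Laplace transform over the cone. -/
def laplace (F : (Fin (l + 1) → ℝ) → W) (ζ : Fin (l + 1) → ℂ) : W :=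
  ∫ v in cone l, Complex.exp (-pairing v ζ) • F v

/-- The density whose Laplace transform is the derivative of the Laplace transform. -/
def derivDensity (F : (Fin (l + 1) → ℝ) → W) (v : Fin (l + 1) → ℝ) :
    (Fin (l + 1) → ℂ) →L[ℂ] W :=
  -(pairing v).smulRight (F v)

namespace PolyGrowth

variable {F : (Fin (l + 1) → ℝ) → W} (hF : PolyGrowth F)
include hF

theorem derivDensity : PolyGrowth (derivDensity F) := by
  obtain ⟨hc, C, hC, k, hk⟩ := hF
  refine ⟨?_, (l + 1) * C, by positivity, k + 1, fun v hv => ?_⟩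
  · have h : Continuous fun p : ((Fin (l + 1) → ℂ) →L[ℂ] ℂ) × W => p.1.smulRight p.2 :=
      (isBoundedBilinearMap_smulRight (𝕜 := ℂ)).continuous
    exact (h.comp_continuousOn (continuous_pairing.continuousOn.prodMk hc)).neg
  · rw [HypRep.derivDensity, norm_neg, ContinuousLinearMap.norm_smulRight_apply]
    calc ‖pairing v‖ * ‖F v‖ ≤ ((l + 1) * (1 + ‖v‖)) * (C * (1 + ‖v‖) ^ k) := by
          refine mul_le_mul ((norm_pairing_le v).trans ?_) (hk v hv) (norm_nonneg _) (by positivity)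
          gcongr
          linarith
      _ = (l + 1) * C * (1 + ‖v‖) ^ (k + 1) := by ring

theorem aestronglyMeasurable (ζ : Fin (l + 1) → ℂ) :
    AEStronglyMeasurable (fun v => Complex.exp (-pairing v ζ) • F v)
      (volume.restrict (cone l)) := by
  refine ContinuousOn.aestronglyMeasurable ?_ measurableSet_cone
  refine ContinuousOn.smul (Continuous.continuousOn ?_) hF.1
  exact Complex.continuous_exp.comp (continuous_pairing.clm_apply continuous_const).neg

theorem integrableOn {ζ : Fin (l + 1) → ℂ} (hζ : ζ ∈ tube l) :
    IntegrableOn (fun v => Complex.exp (-pairing v ζ) • F v) (cone l) := by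
  have hm := hF.aestronglyMeasurable ζ
  obtain ⟨ε, hε, h⟩ := hζ
  obtain ⟨-, C, hC, k, hk⟩ := hF
  refine ((integrable_exp_neg_mul_norm_mul_pow hε k).const_mul C).integrableOn.mono' hm ?_
  refine ae_restrict_of_forall_mem measurableSet_cone fun v hv => ?_
  rw [norm_smul, Complex.norm_exp, Complex.neg_re]
  calc Real.exp (-(pairing v ζ).re) * ‖F v‖
      ≤ Real.exp (-(ε * ‖v‖)) * (C * (1 + ‖v‖) ^ k) := by
        refine mul_le_mul (Real.exp_le_exp.2 (neg_le_neg (h v hv))) (hk v hv) (norm_nonneg _)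
          (Real.exp_pos _).le
    _ = C * (Real.exp (-(ε * ‖v‖)) * (1 + ‖v‖) ^ k) := by ring

theorem hasFDerivAt {ζ : Fin (l + 1) → ℂ} (hζ : ζ ∈ tube l) :
    HasFDerivAt (laplace F) (laplace (HypRep.derivDensity F) ζ) ζ := by
  have hint := hF.integrableOn hζ
  have hm' := hF.derivDensity.aestronglyMeasurable ζ
  obtain ⟨ε, hε, h⟩ := hζ
  obtain ⟨-, C, hC, k, hk⟩ := hF.derivDensity
  refine hasFDerivAt_integral_of_dominated_of_fderiv_le
    (F' := fun ζ v => Complex.exp (-pairing v ζ) • HypRep.derivDensity F v)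
    (bound := fun v => C * (Real.exp (-(ε / 2 * ‖v‖)) * (1 + ‖v‖) ^ k))
    (Metric.ball_mem_nhds ζ (show 0 < ε / (2 * (l + 1)) by positivity))
    (Filter.Eventually.of_forall hF.aestronglyMeasurable) hint hm' ?_ ?_ ?_
  · refine ae_restrict_of_forall_mem measurableSet_cone fun v hv η hη => ?_
    rw [norm_smul, Complex.norm_exp, Complex.neg_re]
    calc Real.exp (-(pairing v η).re) * ‖HypRep.derivDensity F v‖
        ≤ Real.exp (-(ε / 2 * ‖v‖)) * (C * (1 + ‖v‖) ^ k) := by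
          refine mul_le_mul (Real.exp_le_exp.2 (neg_le_neg (tube_ball h hη hv))) (hk v hv)
            (norm_nonneg _) (Real.exp_pos _).le
      _ = C * (Real.exp (-(ε / 2 * ‖v‖)) * (1 + ‖v‖) ^ k) := by ring
  · exact ((integrable_exp_neg_mul_norm_mul_pow (by positivity) k).const_mul C).integrableOn
  · refine Filter.Eventually.of_forall fun v η _ => ?_
    have h1 := ((pairing v).hasFDerivAt (x := η)).neg.cexp.smul_const (F v)
    convert! h1 using 1
    ext x
    simp [HypRep.derivDensity, mul_smul]

end PolyGrowth

/-- The derivative of a Laplace transform is again one, of a density with values in a space of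
linear maps; hence `W` is quantified inside the induction. -/
theorem PolyGrowth.contDiffOn_nat.{u} (n : ℕ) : ∀ {W : Type u} [NormedAddCommGroup W]
    [NormedSpace ℂ W] {F : (Fin (l + 1) → ℝ) → W}, PolyGrowth F →
    ContDiffOn ℂ n (laplace F) (tube l) := by
  induction n with
  | zero =>
    intro W _ _ F hF
    exact contDiffOn_zero.2 fun ζ hζ => (hF.hasFDerivAt hζ).continuousAt.continuousWithinAt
  | succ n ih =>
    intro W _ _ F hF
    rw [Nat.cast_succ, contDiffOn_succ_iff_fderiv_of_isOpen isOpen_tube]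
    refine ⟨fun ζ hζ => (hF.hasFDerivAt hζ).differentiableAt.differentiableWithinAt, by simp, ?_⟩
    exact (ih hF.derivDensity).congr fun ζ hζ => (hF.hasFDerivAt hζ).fderiv

open scoped ContDiff in
theorem PolyGrowth.contDiffOn {F : (Fin (l + 1) → ℝ) → W} (hF : PolyGrowth F) :
    ContDiffOn ℂ ∞ (laplace F) (tube l) :=
  contDiffOn_infty.2 fun n => hF.contDiffOn_nat n

/-- The complex covector dual to a real vector under the Lorentz form. -/
def dual (p : Fin (l + 1) → ℝ) : Fin (l + 1) → ℂ := fun i => ((gram l *ᵥ p) i : ℂ)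

theorem pairing_dual (v p : Fin (l + 1) → ℝ) : pairing v (dual p) = (lor v p : ℝ) := by
  simp [pairing_apply, dual, lor, dotProduct]

theorem dual_mem_tube {p : Fin (l + 1) → ℝ} (hp : p ∈ cone l) : dual p ∈ tube l := by
  obtain ⟨ε, hε, h⟩ := exists_lor_ge hp
  refine ⟨ε, hε, fun v hv => ?_⟩
  rw [pairing_dual, Complex.ofReal_re, norm_eq_of_mem_cone hv, lor_comm]
  exact h v hv

/-- Invariance of Lebesgue measure on the cone. -/
theorem setIntegral_cone_comp {g : Matrix (Fin (l + 1)) (Fin (l + 1)) ℝ} (hdet : |g.det| = 1)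
    (hg : ∀ v, g *ᵥ v ∈ cone l ↔ v ∈ cone l) {E : Type*} [NormedAddCommGroup E] [NormedSpace ℝ E]
    (f : (Fin (l + 1) → ℝ) → E) : ∫ v in cone l, f (g *ᵥ v) = ∫ v in cone l, f v := by
  have hne : g.det ≠ 0 := by
    intro h
    rw [h] at hdet
    simp at hdet
  have hmap : Measure.map (fun v => g *ᵥ v) volume = (volume : Measure (Fin (l + 1) → ℝ)) := by
    have := Real.map_matrix_volume_pi_eq_smul_volume_pi hne
    rw [abs_inv, hdet, inv_one, ENNReal.ofReal_one, one_smul] at this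
    exact this
  have hmp : MeasurePreserving (fun v : Fin (l + 1) → ℝ => g *ᵥ v) volume volume :=
    ⟨(Continuous.matrix_mulVec continuous_const continuous_id).measurable, hmap⟩
  have hemb : MeasurableEmbedding (fun v : Fin (l + 1) → ℝ => g *ᵥ v) := by
    have hinj : Function.Injective fun v : Fin (l + 1) → ℝ => g *ᵥ v :=
      Matrix.mulVec_injective_of_isUnit ((Matrix.isUnit_iff_isUnit_det g).2 hne.isUnit)
    exact (Continuous.matrix_mulVec continuous_const continuous_id).measurableEmbedding hinj
  have := hmp.setIntegral_preimage_emb hemb f (cone l)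
  rw [← this]
  congr 2
  ext v
  exact (hg v).symm

theorem mulVec_mem_cone_iff (g : G l) (v : Fin (l + 1) → ℝ) :
    g.mat *ᵥ v ∈ cone l ↔ v ∈ cone l := by
  refine ⟨fun h => ?_, mulVec_mem_cone g⟩
  have := mulVec_mem_cone g⁻¹ h
  rwa [mat_inv_mulVec_mulVec] at this

theorem setIntegral_cone_mulVec (g : G l) {E : Type*} [NormedAddCommGroup E] [NormedSpace ℝ E]
    (f : (Fin (l + 1) → ℝ) → E) : ∫ v in cone l, f (g.mat *ᵥ v) = ∫ v in cone l, f v :=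
  setIntegral_cone_comp (by rw [det_mat, abs_one]) (mulVec_mem_cone_iff g) f

/-! ### A uniqueness theorem for Laplace transforms on the cone -/

section

variable {W : Type*} [NormedAddCommGroup W] [NormedSpace ℂ W]

/-- Multiplication by the Lorentz invariant function `exp(-c ⟨v, v⟩)`. -/
def damp (c : ℕ) (F : (Fin (l + 1) → ℝ) → W) (v : Fin (l + 1) → ℝ) : W :=
  (Real.exp (-(c * lor v v)) : ℂ) • F v

/-- The factor is at most one since `⟨v, v⟩ > 0` on the cone. Being invariant it respects
equivariance, and its powers supply the moments in the variable `exp(-⟨v, v⟩)`. -/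
theorem PolyGrowth.damp {F : (Fin (l + 1) → ℝ) → W} (hF : PolyGrowth F) (c : ℕ) :
    PolyGrowth (damp c F) := by
  obtain ⟨hc, C, hC, k, hk⟩ := hF
  refine ⟨ContinuousOn.smul (Continuous.continuousOn ?_) hc, C, hC, k, fun v hv => ?_⟩
  · exact Complex.continuous_ofReal.comp
      (Real.continuous_exp.comp (continuous_const.mul continuous_lor_self).neg)
  · rw [HypRep.damp, norm_smul, Complex.norm_real, Real.norm_of_nonneg (Real.exp_pos _).le]
    refine (mul_le_of_le_one_left (norm_nonneg _) ?_).trans (hk v hv)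
    rw [Real.exp_le_one_iff, neg_nonpos]
    exact mul_nonneg (Nat.cast_nonneg c) hv.2.le

end

/-- Polynomial moments determine an integrable function with values in a cube. -/
theorem integral_comp_smul_eq_zero_of_moments {Ω : Type*} [MeasurableSpace Ω] {μ : Measure Ω}
    {n : ℕ} {T : Ω → Fin n → ℝ} (hT : Measurable T) (hT01 : ∀ᵐ x ∂μ, T x ∈ Icc 0 1) {h : Ω → ℂ}
    (hh : Integrable h μ) (hmom : ∀ u : Fin n → ℕ, ∫ x, ((∏ i, T x i ^ u i : ℝ) : ℂ) * h x ∂μ = 0)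
    {g : (Fin n → ℝ) → ℝ} (hg : Continuous g) : ∫ x, (g (T x) : ℂ) * h x ∂μ = 0 := by
  have hbdd : ∀ p : (Fin n → ℝ) → ℝ, Continuous p →
      Integrable (fun x => (p (T x) : ℂ) * h x) μ := by
    intro p hp
    obtain ⟨C, hC⟩ := (isCompact_Icc (a := (0 : Fin n → ℝ)) (b := 1)).exists_bound_of_continuousOn
      hp.continuousOn
    refine hh.bdd_mul (c := C)
      (Complex.measurable_ofReal.comp (hp.measurable.comp hT)).aestronglyMeasurable ?_
    filter_upwards [hT01] with x hx
    rw [Complex.norm_real]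
    exact hC _ hx
  have hpoly : ∀ p : MvPolynomial (Fin n) ℝ,
      ∫ x, (MvPolynomial.eval (T x) p : ℂ) * h x ∂μ = 0 := by
    intro p
    induction p using MvPolynomial.induction_on' with
    | monomial u r =>
      simp only [MvPolynomial.eval_monomial, Finsupp.prod_fintype, pow_zero, implies_true,
        Complex.ofReal_mul, mul_assoc]
      rw [integral_const_mul, hmom u, mul_zero]
    | add p q hp hq =>
      simp only [map_add, Complex.ofReal_add, add_mul]
      rw [integral_add (hbdd _ (MvPolynomial.continuous_eval p))
        (hbdd _ (MvPolynomial.continuous_eval q)), hp, hq, add_zero]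
  let X := Icc (0 : Fin n → ℝ) 1
  let coord : Fin n → C(X, ℝ) := fun i => ⟨fun x => x.1 i, (continuous_apply i).comp continuous_subtype_val⟩
  have haeval : ∀ (p : MvPolynomial (Fin n) ℝ) (x : X),
      MvPolynomial.aeval coord p x = MvPolynomial.eval x.1 p := by
    intro p x
    induction p using MvPolynomial.induction_on with
    | C a => simp
    | add p q hp hq => simp [hp, hq]
    | mul_X p i hp => simp [hp, coord]
  have hsep : (MvPolynomial.aeval (R := ℝ) coord).range.SeparatesPoints := by
    intro x y hxy
    obtain ⟨i, hi⟩ := Function.ne_iff.1 fun h => hxy (Subtype.ext h)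
    exact ⟨coord i, ⟨coord i, ⟨MvPolynomial.X i, by simp⟩, rfl⟩, hi⟩
  have hle : ∀ δ > 0, ‖∫ x, (g (T x) : ℂ) * h x ∂μ‖ ≤ δ * ∫ x, ‖h x‖ ∂μ := by
    intro δ hδ
    obtain ⟨⟨_, p, rfl⟩, hp⟩ :=
      ContinuousMap.exists_mem_subalgebra_near_continuous_of_separatesPoints _ hsep
        (fun x : X => g x.1) (hg.comp continuous_subtype_val) δ hδ
    have h1 : ∫ x, (g (T x) : ℂ) * h x ∂μ =
        ∫ x, ((g (T x) : ℂ) * h x - (MvPolynomial.eval (T x) p : ℂ) * h x) ∂μ := by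
      rw [integral_sub (hbdd _ hg) (hbdd _ (MvPolynomial.continuous_eval p)), hpoly, sub_zero]
    rw [h1, ← integral_const_mul]
    refine norm_integral_le_of_norm_le (hh.norm.const_mul δ) ?_
    filter_upwards [hT01] with x hx
    rw [← sub_mul, norm_mul, ← Complex.ofReal_sub, Complex.norm_real, norm_sub_rev]
    gcongr
    have := hp ⟨T x, hx⟩
    simp only [RingHom.coe_coe, AlgHom.toRingHom_eq_coe] at this
    have h2 := haeval p ⟨T x, hx⟩
    simp only at h2
    rw [← h2]
    exact this.le
  rw [← norm_le_zero_iff]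
  refine le_of_forall_pos_le_add fun ε hε => ?_
  have hI : 0 ≤ ∫ x, ‖h x‖ ∂μ := integral_nonneg fun _ => norm_nonneg _
  refine (hle (ε / (1 + ∫ x, ‖h x‖ ∂μ)) (by positivity)).trans ?_
  rw [zero_add, div_mul_eq_mul_div, div_le_iff₀ (by positivity)]
  nlinarith

theorem lor_self_le_sq_sub_sq (hl : l ≠ 0) (v : Fin (l + 1) → ℝ) :
    lor v v ≤ v 0 ^ 2 - v (Fin.last l) ^ 2 := by
  have h := Finset.sum_le_sum_of_subset_of_nonneg (f := fun i => v i * v i)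
    (Finset.subset_univ {0, Fin.last l}) fun i _ _ => mul_self_nonneg _
  rw [Finset.sum_pair (zero_ne_last hl)] at h
  rw [lor_eq_two_mul_sub, dotProduct]
  nlinarith

theorem abs_last_lt {v : Fin (l + 1) → ℝ} (hl : l ≠ 0) (hv : v ∈ cone l) :
    |v (Fin.last l)| < v 0 := by
  apply abs_lt_of_sq_lt_sq _ hv.1.le
  linarith [lor_self_le_sq_sub_sq hl v, hv.2]

/-- The light cone coordinates of a vector, and its Lorentz square, in exponential form. -/
def lightCoord (v : Fin (l + 1) → ℝ) : Fin 3 → ℝ :=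
  ![Real.exp (-(v 0 - v (Fin.last l))), Real.exp (-(v 0 + v (Fin.last l))), Real.exp (-lor v v)]

theorem measurable_lightCoord : Measurable (lightCoord : (Fin (l + 1) → ℝ) → _) := by
  refine measurable_pi_lambda _ fun i => Continuous.measurable ?_
  have := continuous_lor_self (l := l)
  fin_cases i <;> simp [lightCoord] <;> fun_prop

/-- A section of `lightCoord`. -/
def lightSection (l : ℕ) (τ : Fin 3 → ℝ) : Fin (l + 1) → ℝ :=
  ((-Real.log (τ 0) - Real.log (τ 1)) / 2) • Pi.single 0 1 +
    ((Real.log (τ 0) - Real.log (τ 1)) / 2) • Pi.single (Fin.last l) 1 +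
    √(Real.log (τ 0) * Real.log (τ 1) + Real.log (τ 2)) • Pi.single (Fin.ofNat (l + 1) 1) 1

theorem measurable_lightSection : Measurable (lightSection l) := by
  unfold lightSection
  fun_prop

/-- Coordinate `1` absorbs the remaining length `√(v₀² - v_l² - ⟨v, v⟩)`; the indices `0`, `1`, `l`
are distinct because `l ≥ 2`. -/
theorem lightSection_lightCoord (hl : 2 ≤ l) (v : Fin (l + 1) → ℝ) :
    lightSection l (lightCoord v) 0 = v 0 ∧
    lightSection l (lightCoord v) (Fin.last l) = v (Fin.last l) ∧
    lor (lightSection l (lightCoord v)) (lightSection l (lightCoord v)) = lor v v := by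
  have h0 := zero_ne_last (show l ≠ 0 by omega)
  have h1 : (0 : Fin (l + 1)) ≠ Fin.ofNat (l + 1) 1 := by
    simp [Fin.ext_iff, Nat.mod_eq_of_lt (show 1 < l + 1 by omega)]
  have h2 : Fin.last l ≠ Fin.ofNat (l + 1) 1 := by
    simp [Fin.ext_iff, Nat.mod_eq_of_lt (show 1 < l + 1 by omega)]
    omega
  have hnn : 0 ≤ v 0 ^ 2 - v (Fin.last l) ^ 2 - lor v v := by
    linarith [lor_self_le_sq_sub_sq (show l ≠ 0 by omega) v]
  have hform : lightSection l (lightCoord v) = v 0 • Pi.single 0 1 +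
      v (Fin.last l) • Pi.single (Fin.last l) 1 +
      √(v 0 ^ 2 - v (Fin.last l) ^ 2 - lor v v) • Pi.single (Fin.ofNat (l + 1) 1) 1 := by
    unfold lightSection
    simp only [lightCoord, Matrix.cons_val_zero, Matrix.cons_val_one, Matrix.cons_val, Real.log_exp]
    congr 3 <;> ring_nf
  rw [hform]
  generalize Fin.ofNat (l + 1) 1 = j at h1 h2
  generalize hr : √(v 0 ^ 2 - v (Fin.last l) ^ 2 - lor v v) = r
  have hr2 : r ^ 2 = v 0 ^ 2 - v (Fin.last l) ^ 2 - lor v v := by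
    rw [← hr, Real.sq_sqrt hnn]
  refine ⟨by simp [h0, h1], by simp [h0.symm, h2], ?_⟩
  rw [lor_eq_two_mul_sub]
  simp [h0, h1, h2, h0.symm, h1.symm, h2.symm]
  linarith

/-- A function on the cone which depends only on `v₀`, `v_l` and `⟨v, v⟩` is determined by its
Laplace transforms in the plane of `e₀` and `e_l`. -/
theorem eq_zero_of_laplace_eq_zero (hl : 2 ≤ l) {f : (Fin (l + 1) → ℝ) → ℂ} (hf : PolyGrowth f)
    (hfac : ∀ v ∈ cone l, ∀ v' ∈ cone l, v 0 = v' 0 → v (Fin.last l) = v' (Fin.last l) →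
      lor v v = lor v' v' → f v = f v')
    (hmom : ∀ a b : ℝ, 0 < a → 0 < b → ∀ c : ℕ,
      laplace (damp c f) (dual ((a + b) • e₀ l + (a - b) • eₗ l)) = 0)
    {v : Fin (l + 1) → ℝ} (hv : v ∈ cone l) : f v = 0 := by
  have hl0 : l ≠ 0 := by omega
  -- `U` is `f` expressed in the light cone coordinates, with the weight `τ₀τ₁ = exp(-2v₀)` to make
  -- it integrable.
  set U : (Fin 3 → ℝ) → ℂ := fun τ => ((τ 0 * τ 1 : ℝ) : ℂ) * (cone l).indicator f (lightSection l τ)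
    with hU
  have hUmeas : Measurable U := by
    have h1 : Measurable ((cone l).indicator f) := by
      classical
      rw [← Set.piecewise_eq_indicator]
      exact hf.1.measurable_piecewise continuousOn_const measurableSet_cone
    have h2 := h1.comp (measurable_lightSection (l := l))
    exact (Complex.measurable_ofReal.comp
      ((measurable_pi_apply 0).mul (measurable_pi_apply 1))).mul h2
  have hUT : ∀ v ∈ cone l, U (lightCoord v) = Complex.exp (-pairing v (dual ((2 : ℝ) • e₀ l))) • f v := by
    intro v hv
    obtain ⟨h0, h1, h2⟩ := lightSection_lightCoord hl v
    have hmem : lightSection l (lightCoord v) ∈ cone l := ⟨h0 ▸ hv.1, h2 ▸ hv.2⟩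
    rw [hU]
    simp only
    rw [indicator_of_mem hmem, hfac _ hmem v hv h0 h1 h2, pairing_dual, lor_smul_right, lor_e₀,
      smul_eq_mul, ← Complex.ofReal_neg, ← Complex.ofReal_exp]
    congr 2
    simp only [lightCoord, Matrix.cons_val_zero, Matrix.cons_val_one, ← Real.exp_add]
    ring_nf
  have hint : Integrable (fun v => U (lightCoord v)) (volume.restrict (cone l)) :=
    IntegrableOn.congr_fun (hf.integrableOn
      (dual_mem_tube (smul_mem_cone e₀_mem_cone two_pos)))
      (fun v hv => (hUT v hv).symm) measurableSet_cone
  have hT01 : ∀ᵐ v ∂(volume.restrict (cone l)), lightCoord v ∈ Icc (0 : Fin 3 → ℝ) 1 := by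
    refine ae_restrict_of_forall_mem measurableSet_cone fun v hv => ?_
    have h := abs_lt.1 (abs_last_lt hl0 hv)
    have h2 := hv.2
    constructor <;> intro i <;> fin_cases i <;> simp [lightCoord, Real.exp_nonneg] <;> linarith
  have hmom' : ∀ u : Fin 3 → ℕ, ∫ v in cone l,
      ((∏ i, lightCoord v i ^ u i : ℝ) : ℂ) * U (lightCoord v) = 0 := by
    intro u
    -- The pairing of `v` with the planar point is `a(v₀ - v_l) + b(v₀ + v_l)`; the weight in `U`
    -- shifts both exponents by one, which makes `a` and `b` positive.
    rw [← hmom (u 0 + 1) (u 1 + 1) (by positivity) (by positivity) (u 2)]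
    refine setIntegral_congr_fun measurableSet_cone fun v hv => ?_
    rw [hUT v hv, damp, smul_eq_mul, smul_eq_mul, smul_eq_mul, ← mul_assoc, ← mul_assoc]
    congr 1
    rw [pairing_dual, pairing_dual, ← Complex.ofReal_neg, ← Complex.ofReal_exp,
      ← Complex.ofReal_neg, ← Complex.ofReal_exp, ← Complex.ofReal_mul, ← Complex.ofReal_mul]
    congr 1
    simp only [lightCoord, Fin.prod_univ_three, Matrix.cons_val_zero, Matrix.cons_val_one,
      Matrix.cons_val, ← Real.exp_nat_mul, ← Real.exp_add, lor_add_right, lor_smul_right, lor_e₀,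
      lor_eₗ hl0]
    ring_nf
  have hae : ∀ᵐ τ ∂(Measure.map lightCoord (volume.restrict (cone l))), U τ = 0 := by
    apply ae_eq_zero_of_integral_contDiff_smul_eq_zero
    · apply Integrable.locallyIntegrable
      exact (integrable_map_measure hUmeas.aestronglyMeasurable
        measurable_lightCoord.aemeasurable).2 hint
    · intro g hg _
      have hgU : Measurable fun τ => g τ • U τ := hg.continuous.measurable.smul hUmeas
      rw [integral_map measurable_lightCoord.aemeasurable hgU.aestronglyMeasurable]
      simp only [Complex.real_smul]
      exact integral_comp_smul_eq_zero_of_moments measurable_lightCoord hT01 hint hmom'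
        hg.continuous
  have hae' : f =ᵐ[volume.restrict (cone l)] fun _ => 0 := by
    have h1 := ae_of_ae_map measurable_lightCoord.aemeasurable hae
    filter_upwards [h1, ae_restrict_mem measurableSet_cone] with v h1 hv
    rw [hUT v hv] at h1
    exact (smul_eq_zero.1 h1).resolve_left (Complex.exp_ne_zero _)
  -- Vanishing almost everywhere becomes vanishing everywhere by continuity on the open cone.
  exact Measure.eqOn_open_of_ae_eq hae' isOpen_cone hf.1 continuousOn_const hv

/-! ### Equivariance and analyticity of Laplace transforms -/

section

variable {W W' : Type*} [NormedAddCommGroup W] [NormedSpace ℂ W] [NormedAddCommGroup W']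
  [NormedSpace ℂ W']

theorem PolyGrowth.clm_comp {F : (Fin (l + 1) → ℝ) → W} (hF : PolyGrowth F) (T : W →L[ℂ] W') :
    PolyGrowth fun v => T (F v) := by
  obtain ⟨hc, C, hC, k, hk⟩ := hF
  refine ⟨T.continuous.comp_continuousOn hc, ‖T‖ * C, by positivity, k, fun v hv => ?_⟩
  rw [mul_assoc]
  exact (T.le_opNorm _).trans (mul_le_mul_of_nonneg_left (hk v hv) (norm_nonneg _))

theorem PolyGrowth.coord_smul {F : (Fin (l + 1) → ℝ) → W} (hF : PolyGrowth F) (i : Fin (l + 1)) :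
    PolyGrowth fun v => (v i : ℂ) • F v := by
  obtain ⟨hc, C, hC, k, hk⟩ := hF
  refine ⟨ContinuousOn.smul (Continuous.continuousOn (by fun_prop)) hc, C, hC, k + 1,
    fun v hv => ?_⟩
  rw [norm_smul, Complex.norm_real]
  calc ‖v i‖ * ‖F v‖ ≤ (1 + ‖v‖) * (C * (1 + ‖v‖) ^ k) := by
        refine mul_le_mul ((norm_le_pi_norm v i).trans ?_) (hk v hv) (norm_nonneg _) (by positivity)
        linarith
    _ = C * (1 + ‖v‖) ^ (k + 1) := by ring

theorem laplace_clm_comp [CompleteSpace W] [CompleteSpace W'] {F : (Fin (l + 1) → ℝ) → W}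
    (hF : PolyGrowth F) (T : W →L[ℂ] W') {ζ : Fin (l + 1) → ℂ} (hζ : ζ ∈ tube l) :
    laplace (fun v => T (F v)) ζ = T (laplace F ζ) := by
  unfold laplace
  rw [← ContinuousLinearMap.integral_comp_comm T (hF.integrableOn hζ)]
  simp only [map_smul]

theorem laplace_damp_clm_comp [CompleteSpace W] [CompleteSpace W'] {F : (Fin (l + 1) → ℝ) → W}
    (hF : PolyGrowth F) (T : W →L[ℂ] W') (c : ℕ) {ζ : Fin (l + 1) → ℂ} (hζ : ζ ∈ tube l) :
    laplace (damp c fun v => T (F v)) ζ = T (laplace (damp c F) ζ) := by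
  rw [← laplace_clm_comp (hF.damp c) T hζ]
  congr 1
  ext v
  simp [damp]

/-- Equivariance of the Laplace transform. -/
theorem laplace_damp_mulVec {F : (Fin (l + 1) → ℝ) → W} (g : G l) (T : W ≃ₗᵢ[ℂ] W)
    (hFT : ∀ v ∈ cone l, F (g.mat *ᵥ v) = T (F v)) (c : ℕ) (p : Fin (l + 1) → ℝ) :
    laplace (damp c F) (dual (g.mat *ᵥ p)) = T (laplace (damp c F) (dual p)) := by
  unfold laplace
  rw [← setIntegral_cone_mulVec g, ← LinearIsometryEquiv.coe_toContinuousLinearEquiv,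
    ← ContinuousLinearEquiv.integral_comp_comm]
  refine setIntegral_congr_fun measurableSet_cone fun v hv => ?_
  simp only [damp, pairing_dual, lor_mulVec, hFT v hv, map_smul,
    LinearIsometryEquiv.coe_toContinuousLinearEquiv]

/-- The Laplace transform is real analytic along the orbits of `A`. -/
theorem analyticOnNhd_laplace_boost (hl : l ≠ 0) [CompleteSpace W] {F : (Fin (l + 1) → ℝ) → W}
    (hF : PolyGrowth F) {r : ℝ} (hr : 0 < r) :
    AnalyticOnNhd ℝ (fun t => laplace F (dual (r • (boost l t).mat *ᵥ e₀ l))) univ := by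
  intro t _
  -- The holomorphic extension of the orbit of `A` in the dual space; the minus sign comes from the
  -- Gram matrix.
  let ζ : ℂ → Fin (l + 1) → ℂ := fun z =>
    ((r : ℂ) * Complex.cosh z) • Pi.single 0 1 - ((r : ℂ) * Complex.sinh z) • Pi.single (Fin.last l) 1
  have hζ : ∀ s : ℝ, ζ s = dual (r • (boost l s).mat *ᵥ e₀ l) := by
    intro s
    have h0 := zero_ne_last hl
    ext i
    rw [boost_mulVec_e₀ hl]
    simp only [ζ, dual, gram, Matrix.mulVec_diagonal, Pi.sub_apply, Pi.smul_apply, Pi.add_apply,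
      smul_eq_mul]
    by_cases hi : i = 0
    · subst hi
      simp [h0]
    · by_cases hi' : i = Fin.last l
      · subst hi'
        simp [h0.symm]
      · simp [hi, hi']
  have hζd : Differentiable ℂ ζ := by
    refine Differentiable.sub ?_ ?_
    · exact ((Complex.differentiable_cosh).const_mul _).smul_const _
    · exact ((Complex.differentiable_sinh).const_mul _).smul_const _
  have hopen : IsOpen (ζ ⁻¹' tube l) := isOpen_tube.preimage hζd.continuous
  have hmem : (t : ℂ) ∈ ζ ⁻¹' tube l := by
    rw [mem_preimage, hζ]
    exact dual_mem_tube (smul_mem_cone (mulVec_mem_cone _ e₀_mem_cone) hr)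
  have hdiff : DifferentiableOn ℂ (fun z => laplace F (ζ z)) (ζ ⁻¹' tube l) := fun z hz =>
    ((hF.hasFDerivAt hz).differentiableAt.comp z hζd.differentiableAt).differentiableWithinAt
  have han : AnalyticAt ℂ (fun z => laplace F (ζ z)) t := hdiff.analyticAt (hopen.mem_nhds hmem)
  have h2 : AnalyticAt ℝ (fun s : ℝ => laplace F (ζ (Complex.ofRealCLM s))) t :=
    AnalyticAt.comp (g := fun z => laplace F (ζ z)) (f := Complex.ofRealCLM)
      (han.restrictScalars (𝕜 := ℝ)) (Complex.ofRealCLM.analyticAt t)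
  simpa only [Complex.ofRealCLM_apply, hζ] using h2

end

/-- Here `r = 2√(ab)` and `exp(2s) = a/b`. -/
theorem planar_eq (hl : l ≠ 0) {a b : ℝ} (ha : 0 < a) (hb : 0 < b) :
    ∃ r > (0 : ℝ), ∃ s : ℝ, (a + b) • e₀ l + (a - b) • eₗ l = r • (boost l s).mat *ᵥ e₀ l := by
  refine ⟨2 * Real.exp ((Real.log a + Real.log b) / 2), by positivity,
    (Real.log a - Real.log b) / 2, ?_⟩
  have h1 : Real.exp ((Real.log a + Real.log b) / 2) * Real.exp ((Real.log a - Real.log b) / 2)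
      = a := by
    rw [← Real.exp_add]; ring_nf; exact Real.exp_log ha
  have h2 : Real.exp ((Real.log a + Real.log b) / 2) * Real.exp (-((Real.log a - Real.log b) / 2))
      = b := by
    rw [← Real.exp_add]; ring_nf; exact Real.exp_log hb
  rw [boost_mulVec_e₀ hl, smul_add, smul_smul, smul_smul, Real.cosh_eq, Real.sinh_eq]
  congr 2
  · linear_combination -h1 - h2
  · linear_combination -h1 + h2

namespace UnitaryRep

variable {V : Type*} [NormedAddCommGroup V] [InnerProductSpace ℂ V]
  {π : UnitaryRep (G l) V}

/-! ### Analytic vectors of `A` -/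

theorem dop_smul (X : 𝔤 l) (c : ℝ) (v : V) : π.dop (c • X) v = c • π.dop X v := by
  unfold dop
  have := deriv_comp_mul_left c (fun t : ℝ => π.op (expG (t • X)) v) 0
  simp only [mul_zero] at this
  rw [← this]
  congr 1
  ext t
  rw [smul_smul, mul_comm]

theorem dop_const_smul (X : 𝔤 l) (c : ℝ) (v : V) : π.dop X (c • v) = c • π.dop X v := by
  unfold dop
  rw [← deriv_fun_const_smul_field]
  congr 1
  ext t
  exact map_smul (π.op _) (c : ℂ) v

section Analytic

variable {v : V} (hv : AnalyticOnNhd ℝ (fun t => π.op (boost l t) v) univ)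
include hv

theorem differentiable_iteratedDeriv_boost [CompleteSpace V] (n : ℕ) :
    Differentiable ℝ (iteratedDeriv n fun t => π.op (boost l t) v) :=
  fun t => ((hv.iterated_deriv n t (mem_univ t)).differentiableAt.congr_of_eventuallyEq
    (by rw [iteratedDeriv_eq_iterate]))

theorem iteratedDeriv_boost [CompleteSpace V] (n : ℕ) (t : ℝ) :
    iteratedDeriv n (fun t => π.op (boost l t) v) t =
      π.op (boost l t) (iteratedDeriv n (fun t => π.op (boost l t) v) 0) := by
  induction n generalizing t with
  | zero => simp [boost_zero]
  | succ n ih =>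
    rw [iteratedDeriv_succ]
    have hd := differentiable_iteratedDeriv_boost hv n
    have h1 : HasDerivAt (fun s => iteratedDeriv n (fun t => π.op (boost l t) v) (t + s))
        (π.op (boost l t) (deriv (iteratedDeriv n fun t => π.op (boost l t) v) 0)) 0 := by
      have h2 := ((π.op (boost l t)).toContinuousLinearEquiv.toContinuousLinearMap.restrictScalars
        ℝ).hasFDerivAt.comp_hasDerivAt 0 (hd 0).hasDerivAt
      refine h2.congr_of_eventuallyEq (Filter.Eventually.of_forall fun s => ?_)
      change iteratedDeriv n _ (t + s) = π.op (boost l t) (iteratedDeriv n _ s)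
      rw [ih (t + s), ih s, boost_add, op_mul_apply]
    have h3 : HasDerivAt (fun s => iteratedDeriv n (fun t => π.op (boost l t) v) (t + s))
        (deriv (iteratedDeriv n fun t => π.op (boost l t) v) t) 0 := by
      have := (hd (t + 0)).hasDerivAt.comp_const_add t 0
      simpa using this
    exact h3.unique h1

theorem dop_iteratedDeriv_boost [CompleteSpace V] (n : ℕ) :
    π.dop (H₀ l) (iteratedDeriv n (fun t => π.op (boost l t) v) 0) =
      iteratedDeriv (n + 1) (fun t => π.op (boost l t) v) 0 := by
  rw [iteratedDeriv_succ, dop]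
  congr 1
  ext t
  exact (iteratedDeriv_boost hv n t).symm

/-- As `𝔞` is spanned by `H₀`, each word acts as a scalar times a power of `H₀`, that is, as an
iterated derivative of the orbit at zero. -/
theorem foldr_dop [CompleteSpace V] (L : List (𝔤 l)) (hL : ∀ Y ∈ L, Y ∈ 𝔞 l) :
    ∃ c : ℝ, L.foldr π.dop v = c • iteratedDeriv L.length (fun t => π.op (boost l t) v) 0 := by
  induction L with
  | nil => exact ⟨1, by simp [boost_zero]⟩
  | cons Y L ih =>
    obtain ⟨c, hc⟩ := ih fun Z hZ => hL Z (List.mem_cons_of_mem _ hZ)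
    obtain ⟨a, rfl⟩ := Submodule.mem_span_singleton.1 (hL Y List.mem_cons_self)
    refine ⟨a * c, ?_⟩
    rw [List.foldr_cons, hc, dop_smul, dop_const_smul, dop_iteratedDeriv_boost hv, smul_smul,
      List.length_cons]

theorem iteratedDeriv_mem_envelope [CompleteSpace V] (n : ℕ) :
    iteratedDeriv n (fun t => π.op (boost l t) v) 0 ∈ π.envelope (𝔞 l) v := by
  refine Submodule.subset_span ⟨List.replicate n (H₀ l), fun Y hY => ?_, ?_⟩
  · rw [List.eq_of_mem_replicate hY]
    exact Submodule.mem_span_singleton_self _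
  · induction n with
    | zero => simp [boost_zero]
    | succ n ih => rw [List.replicate_succ, List.foldr_cons, ← ih, dop_iteratedDeriv_boost hv]

theorem iteratedDeriv_inner_boost [CompleteSpace V] (w : V) (n : ℕ) :
    iteratedDeriv n (fun t => ⟪w, π.op (boost l t) v⟫_ℂ) =
      fun t => ⟪w, iteratedDeriv n (fun t => π.op (boost l t) v) t⟫_ℂ := by
  induction n with
  | zero => simp
  | succ n ih =>
    rw [iteratedDeriv_succ, ih]
    ext t
    rw [iteratedDeriv_succ]
    exact (((innerSL ℂ w).restrictScalars ℝ).hasFDerivAt.comp_hasDerivAt t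
      (differentiable_iteratedDeriv_boost hv n t).hasDerivAt).deriv

/-- For an analytic vector of `A`, the vectors orthogonal to `U(𝔞) v` are those orthogonal to the
orbit `π(A) v`. -/
theorem mem_envelope_orthogonal_iff [CompleteSpace V] (w : V) :
    w ∈ (π.envelope (𝔞 l) v)ᗮ ↔ ∀ t, ⟪w, π.op (boost l t) v⟫_ℂ = 0 := by
  rw [Submodule.mem_orthogonal']
  constructor
  · intro h
    have han : AnalyticOnNhd ℝ (fun t => ⟪w, π.op (boost l t) v⟫_ℂ) univ := fun t ht =>
      (((innerSL ℂ w).restrictScalars ℝ).analyticAt _).comp (hv t ht)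
    -- All derivatives of the coefficient vanish at zero, so its order is infinite and the identity
    -- theorem applies on the whole line.
    have hord : analyticOrderAt (fun t => ⟪w, π.op (boost l t) v⟫_ℂ) (0 : ℝ) = ⊤ := by
      rw [ENat.eq_top_iff_forall_ge]
      intro n
      rw [natCast_le_analyticOrderAt_iff_iteratedDeriv_eq_zero (han 0 (mem_univ _))]
      intro i _
      rw [iteratedDeriv_inner_boost hv]
      exact h _ (iteratedDeriv_mem_envelope hv i)
    have := han.eqOn_zero_of_preconnected_of_eventuallyEq_zero isPreconnected_univ (mem_univ 0)
      (analyticOrderAt_eq_top.1 hord)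
    exact fun t => this (mem_univ t)
  · intro h u hu
    have h0 : ∀ n, ⟪w, iteratedDeriv n (fun t => π.op (boost l t) v) 0⟫_ℂ = 0 := by
      intro n
      have := congrFun (iteratedDeriv_inner_boost hv w n) 0
      rw [← this]
      simp only [h]
      simp
    refine Submodule.span_induction (p := fun u _ => ⟪w, u⟫_ℂ = 0) ?_ (inner_zero_right _)
      (fun x y _ _ hx hy => by rw [inner_add_right, hx, hy, add_zero])
      (fun c x _ hx => by rw [inner_smul_right, hx, mul_zero]) hu
    rintro _ ⟨L, hL, rfl⟩
    obtain ⟨c, hc⟩ := foldr_dop hv L hL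
    rw [hc]
    change ⟪w, (c : ℂ) • _⟫_ℂ = 0
    rw [inner_smul_right, h0, mul_zero]

end Analytic

theorem mem_span_orbit_orthogonal_iff (v w : V) :
    w ∈ (Submodule.span ℂ ((fun a => π.op a v) '' A l))ᗮ ↔
      ∀ t, ⟪w, π.op (boost l t) v⟫_ℂ = 0 := by
  rw [Submodule.mem_orthogonal', A_eq_range]
  constructor
  · exact fun h t => h _ (Submodule.subset_span ⟨_, ⟨t, rfl⟩, rfl⟩)
  · intro h u hu
    refine Submodule.span_induction (p := fun u _ => ⟪w, u⟫_ℂ = 0) ?_ (inner_zero_right _)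
      (fun x y _ _ hx hy => by rw [inner_add_right, hx, hy, add_zero])
      (fun c x _ hx => by rw [inner_smul_right, hx, mul_zero]) hu
    rintro _ ⟨_, ⟨t, rfl⟩, rfl⟩
    exact h t

theorem topologicalClosure_envelope [CompleteSpace V] {v : V}
    (hv : AnalyticOnNhd ℝ (fun t => π.op (boost l t) v) univ) :
    (π.envelope (𝔞 l) v).topologicalClosure =
      (Submodule.span ℂ ((fun a => π.op a v) '' A l)).topologicalClosure := by
  rw [← Submodule.orthogonal_orthogonal_eq_closure, ← Submodule.orthogonal_orthogonal_eq_closure]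
  congr 1
  ext w
  rw [mem_envelope_orthogonal_iff hv, mem_span_orbit_orthogonal_iff]

/-! ### Laplace transforms of the orbit map -/

section Orbit

variable (hl : 2 ≤ l) {φ : V} (hφ : φ ∈ π.fixed (K l))
include hl hφ

theorem polyGrowth_orbit : PolyGrowth (π.orbit φ) :=
  ⟨continuousOn_orbit hφ hl, ‖φ‖, norm_nonneg _, 0, fun v _ => by
    rw [pow_zero, mul_one]; exact norm_orbit_le π φ v⟩

theorem laplace_orbit_mulVec (g : G l) (c : ℕ) (p : Fin (l + 1) → ℝ) :
    laplace (damp c (π.orbit φ)) (dual (g.mat *ᵥ p)) =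
      π.op g (laplace (damp c (π.orbit φ)) (dual p)) :=
  laplace_damp_mulVec g (π.op g) (fun _ hv => orbit_mulVec hφ hl g hv) c p

variable [CompleteSpace V] (hπ : π.IsIrreducible) (hφ₀ : φ ≠ 0)
include hπ hφ₀

/-- The transform at `r e₀` is `K`-fixed, hence a multiple of `φ`; equivariance transports this to
`r g e₀`. Positivity of `r` plays no role, since equivariance of the Bochner integral does not
depend on convergence. -/
theorem exists_laplace_orbit_eq (r : ℝ) (c : ℕ) : ∃ C : ℂ, ∀ g : G l,
    laplace (damp c (π.orbit φ)) (dual (r • g.mat *ᵥ e₀ l)) = C • π.op g φ := by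
  have hfix : laplace (damp c (π.orbit φ)) (dual (r • e₀ l)) ∈ π.fixed (K l) := by
    intro k hk
    rw [← laplace_orbit_mulVec hl hφ, Matrix.mulVec_smul, mem_K.1 hk]
  obtain ⟨C, hC⟩ := exists_smul_eq_of_fixed (exists_inv_eq hl) hπ hφ₀ hφ hfix
  refine ⟨C, fun g => ?_⟩
  rw [← Matrix.mulVec_smul, laplace_orbit_mulVec hl hφ, hC, map_smul]

theorem laplace_inner_orbit_planar {w : V} (hw : ∀ t, ⟪w, π.op (boost l t) φ⟫_ℂ = 0) {a b : ℝ}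
    (ha : 0 < a) (hb : 0 < b) (c : ℕ) :
    laplace (damp c fun v => ⟪w, π.orbit φ v⟫_ℂ) (dual ((a + b) • e₀ l + (a - b) • eₗ l)) = 0 := by
  obtain ⟨r, hr, s, h⟩ := planar_eq (show l ≠ 0 by omega) ha hb
  rw [h]
  obtain ⟨C, hC⟩ := exists_laplace_orbit_eq hl hφ hπ hφ₀ r c
  have := laplace_damp_clm_comp (polyGrowth_orbit hl hφ) (innerSL ℂ w) c
    (dual_mem_tube (smul_mem_cone (mulVec_mem_cone (boost l s) e₀_mem_cone) hr))
  simp only [innerSL_apply_apply] at this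
  rw [this, hC, inner_smul_right, hw, mul_zero]

/-- Otherwise all transforms of `F` vanish. The function `⟨φ, F(v)⟩` is `K`-invariant, so it depends
on `v₀` and `⟨v, v⟩` only and the uniqueness theorem makes it zero; but at `e₀` it is `‖φ‖²`. -/
theorem exists_op_eq_smul_laplace : ∃ r > (0 : ℝ), ∃ (c : ℕ) (C : ℂ), ∀ g : G l,
    π.op g φ = C • laplace (damp c (π.orbit φ)) (dual (r • g.mat *ᵥ e₀ l)) := by
  by_contra! hne
  have hzero : ∀ r > (0 : ℝ), ∀ (c : ℕ) (g : G l),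
      laplace (damp c (π.orbit φ)) (dual (r • g.mat *ᵥ e₀ l)) = 0 := by
    intro r hr c g
    obtain ⟨C, hC⟩ := exists_laplace_orbit_eq hl hφ hπ hφ₀ r c
    by_cases hC0 : C = 0
    · rw [hC, hC0, zero_smul]
    · obtain ⟨h, hh⟩ := hne r hr c C⁻¹
      rw [hC, smul_smul, inv_mul_cancel₀ hC0, one_smul] at hh
      exact absurd rfl hh
  have := eq_zero_of_laplace_eq_zero hl ((polyGrowth_orbit hl hφ).clm_comp (innerSL ℂ φ))
    (fun v hv v' hv' h0 _ h2 => by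
      obtain ⟨k, hk, hkv⟩ := exists_mem_K hl h0 h2
      simp only [innerSL_apply_apply]
      rw [← hkv, orbit_mulVec hφ hl k hv, inner_fixed_op_mul π (K l) hk hφ])
    (fun a b ha hb c => by
      obtain ⟨r, hr, s, h⟩ := planar_eq (show l ≠ 0 by omega) ha hb
      rw [h, laplace_damp_clm_comp (polyGrowth_orbit hl hφ) _ c
        (dual_mem_tube (smul_mem_cone (mulVec_mem_cone (boost l s) e₀_mem_cone) hr)), hzero r hr,
        map_zero]) e₀_mem_cone
  simp only [innerSL_apply_apply] at this
  rw [orbit_e₀ hφ] at this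
  exact hφ₀ (inner_self_eq_zero.1 this)

theorem isSmooth_of_mem_fixed : π.IsSmooth φ := by
  obtain ⟨r, hr, c, C, h⟩ := exists_op_eq_smul_laplace hl hφ hπ hφ₀
  intro n X
  simp only [h]
  refine ContDiff.const_smul (R := ℂ) C ?_
  have h1 := (((polyGrowth_orbit hl hφ).damp c).contDiffOn).restrict_scalars ℝ
  refine h1.comp_contDiff ?_ fun t =>
    dual_mem_tube (smul_mem_cone (mulVec_mem_cone _ e₀_mem_cone) hr)
  rw [contDiff_pi]
  intro i
  open scoped Matrix.Norms.Operator in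
  have hexp : ContDiff ℝ ⊤ fun t : Fin n → ℝ =>
      (NormedSpace.exp ((∑ i, t i • X i : 𝔤 l) : Matrix (Fin (l + 1)) (Fin (l + 1)) ℝ)) i 0 := by
    have h2 : ContDiff ℝ ⊤
        (NormedSpace.exp : Matrix (Fin (l + 1)) (Fin (l + 1)) ℝ → _) :=
      (AnalyticOnNhd.contDiff (fun x _ => NormedSpace.exp_analytic (𝕂 := ℝ) x))
    have h3 : ContDiff ℝ ⊤ fun t : Fin n → ℝ =>
        ((∑ i, t i • X i : 𝔤 l) : Matrix (Fin (l + 1)) (Fin (l + 1)) ℝ) := by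
      simp only [Submodule.coe_sum, Submodule.coe_smul]
      exact ContDiff.sum fun i _ => (contDiff_apply ℝ ℝ i).smul contDiff_const
    exact (LinearMap.toContinuousLinearMap
        (Matrix.entryLinearMap ℝ ℝ i 0)).contDiff.comp (h2.comp h3)
  have hform : ∀ t : Fin n → ℝ, dual (r • (expG (∑ i, t i • X i)).mat *ᵥ e₀ l) i =
      Complex.ofRealCLM ((if i = 0 then 1 else -1) * (r * (NormedSpace.exp
        ((∑ i, t i • X i : 𝔤 l) : Matrix (Fin (l + 1)) (Fin (l + 1)) ℝ)) i 0)) := by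
    intro t
    simp [dual, gram, Matrix.mulVec_diagonal, mat_expG]
  simp only [hform]
  exact (Complex.ofRealCLM.contDiff.comp (contDiff_const.mul (contDiff_const.mul hexp))).of_le le_top

theorem analyticOnNhd_boost : AnalyticOnNhd ℝ (fun t => π.op (boost l t) φ) univ := by
  obtain ⟨r, hr, c, C, h⟩ := exists_op_eq_smul_laplace hl hφ hπ hφ₀
  simp only [h]
  exact fun t ht => (analyticAt_const (v := C)).smul (analyticOnNhd_laplace_boost (by omega)
    ((polyGrowth_orbit hl hφ).damp c) hr t ht)

omit hπ hφ₀ [CompleteSpace V] hl in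
theorem op_A_mem_fixed_M {a : G l} (ha : a ∈ A l) : π.op a φ ∈ π.fixed (M l) := by
  intro m hm
  have hc : a * m = m * a := Subgroup.mem_centralizer_iff.1 hm.2 a ha
  rw [← op_mul_apply, ← hc, op_mul_apply, hφ m hm.1]

theorem eq_zero_of_mem_fixed_M (hl' : 2 < l) {w : V} (hwM : w ∈ π.fixed (M l))
    (hw : ∀ t, ⟪w, π.op (boost l t) φ⟫_ℂ = 0) : w = 0 := by
  refine hπ.eq_zero_of_inner_eq_zero hφ₀ fun g => ?_
  have := eq_zero_of_laplace_eq_zero hl ((polyGrowth_orbit hl hφ).clm_comp (innerSL ℂ w))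
    (fun v hv v' hv' h0 h1 h2 => by
      obtain ⟨k, hk, hkv⟩ := exists_mem_M hl' h0 h1 h2
      simp only [innerSL_apply_apply]
      rw [← hkv, orbit_mulVec hφ hl k hv, inner_fixed_op_mul π (M l) hk hwM])
    (fun a b ha hb c => laplace_inner_orbit_planar hl hφ hπ hφ₀ hw ha hb c)
    (mulVec_mem_cone g e₀_mem_cone)
  simp only [innerSL_apply_apply] at this
  rwa [orbit_mulVec_e₀ hφ] at this

theorem topologicalClosure_span_orbit_eq (hl' : 2 < l) :
    (Submodule.span ℂ ((fun a => π.op a φ) '' A l)).topologicalClosure = π.fixed (M l) := by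
  set S := (Submodule.span ℂ ((fun a => π.op a φ) '' A l)).topologicalClosure with hS
  have hle : S ≤ π.fixed (M l) := by
    refine Submodule.topologicalClosure_minimal _ (Submodule.span_le.2 ?_) (π.isClosed_fixed _)
    rintro _ ⟨a, ha, rfl⟩
    exact op_A_mem_fixed_M hφ ha
  refine le_antisymm hle fun n hn => ?_
  have hSc : IsClosed (S : Set V) := Submodule.isClosed_topologicalClosure _
  have : CompleteSpace S := hSc.completeSpace_coe
  -- The component of `n` orthogonal to the closed span is still `M`-fixed, because the span lies in
  -- the fixed space.
  have h1 : n - S.starProjection n ∈ π.fixed (M l) :=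
    Submodule.sub_mem _ hn (hle (Submodule.starProjection_apply_mem S n))
  have h2 : n - S.starProjection n ∈ (Submodule.span ℂ ((fun a => π.op a φ) '' A l))ᗮ :=
    Submodule.orthogonal_le (Submodule.le_topologicalClosure _)
      (Submodule.sub_starProjection_mem_orthogonal n)
  rw [mem_span_orbit_orthogonal_iff] at h2
  have h3 := eq_zero_of_mem_fixed_M hl hφ hπ hφ₀ hl' h1 h2
  rw [sub_eq_zero.1 h3]
  exact Submodule.starProjection_apply_mem S n

end Orbit

end UnitaryRep

end Common

/-! ### The case of the hyperbolic plane -/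

theorem eₗ_two_apply : eₗ 2 2 = 1 := Pi.single_eq_same (Fin.last 2) 1

/-- Commuting with a nontrivial boost and fixing `e₀` forces `k` to fix `e_l`; orthogonality and
`det = 1` then leave no choice on `e₁`. -/
theorem eq_one_of_mem_M_two {k : G 2} (hk : k ∈ M 2) : k = 1 := by
  have h0 : k.mat *ᵥ e₀ 2 = e₀ 2 := hk.1
  have h2 : k.mat *ᵥ eₗ 2 = eₗ 2 := by
    have hc : boost 2 1 * k = k * boost 2 1 :=
      Subgroup.mem_centralizer_iff.1 hk.2 _ (boost_mem 1)
    have h := congrArg (fun g : G 2 => g.mat *ᵥ e₀ 2) hc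
    simp only [G.mat_mul, ← Matrix.mulVec_mulVec] at h
    rw [h0, boost_mulVec_e₀ two_ne_zero, Matrix.mulVec_add, Matrix.mulVec_smul, Matrix.mulVec_smul,
      h0, add_right_inj] at h
    exact (smul_right_injective _ (Real.sinh_pos_iff.2 one_pos).ne' h).symm
  have hcol : ∀ i j, k.mat i j = (k.mat *ᵥ Pi.single j 1) i := by
    intro i j
    simp
  have c0 : ∀ i, k.mat i 0 = e₀ 2 i := fun i => by rw [hcol, h0]
  have c2 : ∀ i, k.mat i 2 = eₗ 2 i := fun i => by rw [hcol]; exact congrFun h2 i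
  have r0 : k.mat 0 1 = 0 := by
    have := lor_mulVec k (Pi.single 1 1) (e₀ 2)
    rw [h0, lor_e₀, lor_e₀, ← hcol] at this
    simpa using this
  have r2 : k.mat 2 1 = 0 := by
    have := lor_mulVec k (Pi.single 1 1) (eₗ 2)
    rw [h2, lor_eₗ two_ne_zero, lor_eₗ two_ne_zero, neg_inj] at this
    change (k.mat *ᵥ Pi.single 1 1) 2 = (Pi.single 1 1 : Fin 3 → ℝ) 2 at this
    rw [← hcol] at this
    simpa using this
  have r1 : k.mat 1 1 = 1 := by
    have := det_mat k
    rw [Matrix.det_fin_three, c0, c0, c0, c2, c2, c2, r0, r2] at this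
    simpa [eₗ_two_apply] using this
  apply G.ext_mat
  rw [G.mat_one]
  ext i j
  fin_cases j
  · exact (c0 i).trans (by fin_cases i <;> simp)
  · fin_cases i
    · exact r0
    · exact r1
    · exact r2
  · refine (c2 i).trans ?_
    fin_cases i
    · simp [show Fin.last 2 = (2 : Fin 3) from rfl]
    · simp [show Fin.last 2 = (2 : Fin 3) from rfl]
    · exact eₗ_two_apply

/-- The root equation together with skewness leaves one free entry. To first order, `exp(sX)` thus
moves the base point perpendicularly to the plane of `e₀` and `e_l`. -/
theorem mulVec_e₀_of_mem_𝔫 {X : 𝔤 2} (hX : X ∈ 𝔫 2) (hX0 : X ≠ 0) :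
    ∃ κ : ℝ, κ ≠ 0 ∧ X.1 *ᵥ e₀ 2 = κ • Pi.single 1 1 := by
  have hskew : ∀ i j, X.1 j i * (if j = 0 then 1 else -1) =
      (if i = 0 then 1 else -1) * -X.1 i j := by
    intro i j
    have h := congrFun (congrFun ((mem_𝔤 X.1).1 X.2) i) j
    simpa only [gram, Matrix.mul_diagonal, Matrix.diagonal_mul, Matrix.transpose_apply,
      Matrix.neg_apply] using h
  have hbr : ∀ i j, ((H₀ 2).1 * X.1 - X.1 * (H₀ 2).1) i j = X.1 i j := fun i j =>
    congrFun (congrFun (show (H₀ 2).1 * X.1 - X.1 * (H₀ 2).1 = X.1 from hX) i) j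
  have h20 := hbr 2 0
  have h10 := hbr 1 0
  simp [H₀, Matrix.mul_apply, Fin.sum_univ_three, show Fin.last 2 = (2 : Fin 3) from rfl]
    at h20 h10
  have s00 := hskew 0 0
  have s11 := hskew 1 1
  have s22 := hskew 2 2
  have s10 := hskew 1 0
  have s20 := hskew 2 0
  have s21 := hskew 2 1
  simp at s00 s11 s22 s10 s20 s21
  have z00 : X.1 0 0 = 0 := by linarith
  have z11 : X.1 1 1 = 0 := by linarith
  have z22 : X.1 2 2 = 0 := by linarith
  have z20 : X.1 2 0 = 0 := by linarith
  refine ⟨X.1 1 0, fun h => hX0 ?_, ?_⟩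
  · apply Subtype.ext
    ext i j
    change X.1 i j = 0
    fin_cases i <;> fin_cases j <;> simp <;> linarith
  · ext i
    fin_cases i <;> simp [z00, z20]

/-- The reflection `v₁ ↦ -v₁`. -/
def reflection : Matrix (Fin (2 + 1)) (Fin (2 + 1)) ℝ := Matrix.diagonal ![1, -1, 1]

theorem reflection_mulVec (v : Fin (2 + 1) → ℝ) : reflection *ᵥ v = ![v 0, -v 1, v 2] := by
  ext i
  rw [reflection, Matrix.mulVec_diagonal]
  fin_cases i <;> simp

theorem lor_two (v w : Fin (2 + 1) → ℝ) : lor v w = v 0 * w 0 - v 1 * w 1 - v 2 * w 2 := by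
  rw [lor_eq, Fin.sum_univ_two]
  simp only [Fin.succ_zero_eq_one, Fin.succ_one_eq_two]
  ring

theorem lor_reflection (v w : Fin (2 + 1) → ℝ) :
    lor (reflection *ᵥ v) (reflection *ᵥ w) = lor v w := by
  rw [reflection_mulVec, reflection_mulVec, lor_two, lor_two]
  simp

theorem reflection_reflection (v : Fin (2 + 1) → ℝ) : reflection *ᵥ (reflection *ᵥ v) = v := by
  rw [reflection_mulVec, reflection_mulVec]
  ext i
  fin_cases i <;> simp

theorem reflection_mem_cone {v : Fin (2 + 1) → ℝ} (hv : v ∈ cone 2) :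
    reflection *ᵥ v ∈ cone 2 := by
  refine ⟨?_, by rw [lor_reflection]; exact hv.2⟩
  rw [reflection_mulVec]
  exact hv.1

theorem PolyGrowth.comp_reflection {W : Type*} [NormedAddCommGroup W] [NormedSpace ℂ W]
    {F : (Fin (2 + 1) → ℝ) → W} (hF : PolyGrowth F) : PolyGrowth fun v => F (reflection *ᵥ v) := by
  obtain ⟨hc, C, hC, k, hk⟩ := hF
  refine ⟨hc.comp (Continuous.matrix_mulVec continuous_const continuous_id).continuousOn
    fun v hv => reflection_mem_cone hv, C, hC, k, fun v hv => ?_⟩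
  have h := hk _ (reflection_mem_cone hv)
  have h1 : (reflection *ᵥ v) 0 = v 0 := by rw [reflection_mulVec]; rfl
  rwa [norm_eq_of_mem_cone (reflection_mem_cone hv), h1, ← norm_eq_of_mem_cone hv] at h

/-- The reflection preserves the cone, the form, Lebesgue measure and `p`. It has determinant `-1`
and so lies outside `G`; the change of variables asks only for `|det| = 1`. -/
theorem laplace_damp_comp_reflection {W : Type*} [NormedAddCommGroup W] [NormedSpace ℂ W]
    (F : (Fin (2 + 1) → ℝ) → W) (c : ℕ) {p : Fin (2 + 1) → ℝ} (hp : p 1 = 0) :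
    laplace (damp c fun v => F (reflection *ᵥ v)) (dual p) = laplace (damp c F) (dual p) := by
  have hpr : reflection *ᵥ p = p := by
    rw [reflection_mulVec]
    ext i
    fin_cases i <;> simp [hp]
  have hv : ∀ v, lor (reflection *ᵥ v) p = lor v p := fun v => by
    rw [← lor_reflection v p, hpr]
  unfold laplace
  symm
  rw [← setIntegral_cone_comp (g := reflection) (by
    simp [reflection, Matrix.det_diagonal, Fin.prod_univ_three]) fun v =>
      ⟨fun h => by simpa only [reflection_reflection] using reflection_mem_cone h,
        reflection_mem_cone⟩]
  refine integral_congr_ae (Filter.Eventually.of_forall fun v => ?_)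
  simp only [damp, pairing_dual, lor_reflection, hv]

theorem laplace_damp_eq_zero_of_odd {F : (Fin (2 + 1) → ℝ) → ℂ}
    (hF : ∀ v ∈ cone 2, F (reflection *ᵥ v) = -F v) (c : ℕ) {p : Fin (2 + 1) → ℝ} (hp : p 1 = 0) :
    laplace (damp c F) (dual p) = 0 := by
  have h := laplace_damp_comp_reflection F c hp
  have h2 : laplace (damp c fun v => F (reflection *ᵥ v)) (dual p) =
      -laplace (damp c F) (dual p) := by
    unfold laplace
    rw [← integral_neg]
    refine setIntegral_congr_fun measurableSet_cone fun v hv => ?_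
    simp only [damp, hF v hv, smul_neg]
  rw [h2] at h
  exact self_eq_neg.1 h.symm

/-- A uniqueness theorem for the odd and the even part of a function on the cone. -/
theorem eq_zero_of_laplace_eq_zero_two {f : (Fin (2 + 1) → ℝ) → ℂ} (hf : PolyGrowth f)
    (h0 : ∀ a b : ℝ, 0 < a → 0 < b → ∀ c : ℕ,
      laplace (damp c f) (dual ((a + b) • e₀ 2 + (a - b) • eₗ 2)) = 0)
    (h1 : ∀ a b : ℝ, 0 < a → 0 < b → ∀ c : ℕ,
      laplace (damp c fun v => (v 1 : ℂ) • f v) (dual ((a + b) • e₀ 2 + (a - b) • eₗ 2)) = 0)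
    {v : Fin (2 + 1) → ℝ} (hv : v ∈ cone 2) : f v = 0 := by
  have hp : ∀ a b : ℝ, ((a + b) • e₀ 2 + (a - b) • eₗ 2) 1 = 0 := by
    intro a b
    simp [show Fin.last 2 = (2 : Fin 3) from rfl]
  have hfac : ∀ F : (Fin (2 + 1) → ℝ) → ℂ, (∀ v ∈ cone 2, F (reflection *ᵥ v) = F v) →
      ∀ v ∈ cone 2, ∀ v' ∈ cone 2, v 0 = v' 0 → v (Fin.last 2) = v' (Fin.last 2) →
        lor v v = lor v' v' → F v = F v' := by
    intro F hF v hv v' hv' e0 e2 e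
    change v 2 = v' 2 at e2
    rw [lor_two, lor_two, e0, e2] at e
    have hsq : v 1 * v 1 = v' 1 * v' 1 := by linarith
    rcases mul_self_eq_mul_self_iff.1 hsq with e1 | e1
    · congr 1
      ext i
      fin_cases i
      exacts [e0, e1, e2]
    · rw [← hF v' hv', reflection_mulVec]
      congr 1
      ext i
      fin_cases i
      exacts [e0, e1, e2]
  have hsum : PolyGrowth fun v => f v + f (reflection *ᵥ v) := by
    obtain ⟨hc, C, hC, k, hk⟩ := hf
    obtain ⟨hc', C', hC', k', hk'⟩ := PolyGrowth.comp_reflection ⟨hc, C, hC, k, hk⟩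
    refine ⟨hc.add hc', C + C', by positivity, k + k', fun v hv => ?_⟩
    have hx : 1 ≤ 1 + ‖v‖ := by linarith [norm_nonneg v]
    rw [add_mul]
    refine (norm_add_le _ _).trans (add_le_add ((hk v hv).trans ?_) ((hk' v hv).trans ?_))
    · exact mul_le_mul_of_nonneg_left (pow_le_pow_right₀ hx (by omega)) hC
    · exact mul_le_mul_of_nonneg_left (pow_le_pow_right₀ hx (by omega)) hC'
  have hodd : ∀ v ∈ cone 2, f (reflection *ᵥ v) = -f v := by
    intro v hv
    have := eq_zero_of_laplace_eq_zero le_rfl hsum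
      (hfac _ fun v _ => by rw [reflection_reflection, add_comm]) (fun a b ha hb c => by
        have hmem : dual ((a + b) • e₀ 2 + (a - b) • eₗ 2) ∈ tube 2 := by
          obtain ⟨r, hr, s, h⟩ := planar_eq two_ne_zero ha hb
          rw [h]
          exact dual_mem_tube (smul_mem_cone (mulVec_mem_cone _ e₀_mem_cone) hr)
        have hadd : damp c (fun v => f v + f (reflection *ᵥ v)) =
            damp c f + damp c fun v => f (reflection *ᵥ v) := by
          ext v
          simp [damp, mul_add]
        rw [hadd]
        unfold laplace
        simp only [Pi.add_apply, smul_add]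
        rw [integral_add ((hf.damp c).integrableOn hmem)
          ((hf.comp_reflection.damp c).integrableOn hmem)]
        change laplace (damp c f) _ + laplace (damp c fun v => f (reflection *ᵥ v)) _ = 0
        rw [laplace_damp_comp_reflection f c (hp a b), h0 a b ha hb, add_zero]) hv
    exact eq_neg_of_add_eq_zero_right this
  by_cases hv1 : v 1 = 0
  · have hfix : reflection *ᵥ v = v := by
      rw [reflection_mulVec]
      ext i
      fin_cases i <;> simp [hv1]
    have := hodd v hv
    rw [hfix] at this
    exact self_eq_neg.1 this
  -- For odd `f` the function `v₁ f` is even, so it depends on `v₀`, `v₂` and `⟨v, v⟩` only.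
  · have := eq_zero_of_laplace_eq_zero le_rfl (hf.coord_smul 1) (hfac _ fun v hv => by
      rw [hodd v hv, reflection_mulVec]
      simp) h1 hv
    refine (smul_eq_zero.1 this).resolve_left ?_
    exact_mod_cast hv1

open scoped Matrix.Norms.Operator in
theorem hasDerivAt_dual_exp {X : 𝔤 2} {κ : ℝ} (hκ : X.1 *ᵥ e₀ 2 = κ • Pi.single 1 1) (r : ℝ) :
    HasDerivAt (fun s : ℝ => dual (r • (expG (s • X)).mat *ᵥ e₀ 2))
      (dual ((r * κ) • Pi.single 1 1)) 0 := by
  rw [hasDerivAt_pi]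
  intro i
  have h1 : HasDerivAt (fun s : ℝ => NormedSpace.exp (s • X.1)) X.1 0 := by
    have h := hasDerivAt_exp_smul_const X.1 (0 : ℝ)
    rw [zero_smul, NormedSpace.exp_zero, one_mul] at h
    exact h
  have h2 := (LinearMap.toContinuousLinearMap
    (Matrix.entryLinearMap ℝ ℝ i 0)).hasFDerivAt.comp_hasDerivAt 0 h1
  have h3 := (((h2.const_mul r).const_mul
    (if i = 0 then (1 : ℝ) else -1))).ofReal_comp
  change HasDerivAt _ (((if i = 0 then (1 : ℝ) else -1) * (r * X.1 i 0) : ℝ) : ℂ) 0 at h3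
  have h4 : X.1 i 0 = κ * (Pi.single 1 1 : Fin (2 + 1) → ℝ) i := by
    have := congrFun hκ i
    simpa using this
  convert! h3 using 1
  · ext s
    simp [dual, gram, Matrix.mulVec_diagonal, mat_expG]
  · simp [dual, gram, Matrix.mulVec_diagonal, h4, mul_assoc]

/-! ### Even and odd transforms of the orbit map for `l = 2` -/

namespace UnitaryRep

variable {V : Type*} [NormedAddCommGroup V] [InnerProductSpace ℂ V] [CompleteSpace V]
  {π : UnitaryRep (G 2) V} {φ : V} (hφ : φ ∈ π.fixed (K 2))

omit [CompleteSpace V] in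
theorem fixed_M_two : π.fixed (M 2) = ⊤ := by
  rw [eq_top_iff]
  intro v _ k hk
  rw [eq_one_of_mem_M_two hk, op_one_apply]

include hφ

omit [CompleteSpace V] in
theorem polyGrowth_coord_orbit : PolyGrowth fun v => (v 1 : ℂ) • π.orbit φ v :=
  (polyGrowth_orbit le_rfl hφ).coord_smul 1

omit [CompleteSpace V] in
-- Boosts fix `e₁`, hence leave the factor `v₁` unchanged: equivariance survives for `A`.
theorem laplace_coord_orbit_boost (r t : ℝ) (c : ℕ) :
    laplace (damp c fun v => (v 1 : ℂ) • π.orbit φ v) (dual (r • (boost 2 t).mat *ᵥ e₀ 2)) =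
      π.op (boost 2 t) (laplace (damp c fun v => (v 1 : ℂ) • π.orbit φ v) (dual (r • e₀ 2))) := by
  rw [← Matrix.mulVec_smul]
  refine laplace_damp_mulVec (boost 2 t) (π.op (boost 2 t)) (fun v hv => ?_) c _
  have hb : (boost 2 t).mat *ᵥ Pi.single 1 1 = (Pi.single 1 1 : Fin (2 + 1) → ℝ) := by
    apply exp_mulVec_of_mulVec_eq_zero
    change (t • (H₀ 2).1) *ᵥ _ = 0
    rw [Matrix.smul_mulVec, H₀_mulVec two_ne_zero]
    simp [show Fin.last 2 = (2 : Fin 3) from rfl]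
  have h1 : ((boost 2 t).mat *ᵥ v) 1 = v 1 := by
    have := lor_mulVec (boost 2 t) v (Pi.single 1 1)
    rw [hb, lor_two, lor_two] at this
    simpa using this
  rw [h1, orbit_mulVec hφ le_rfl _ hv, map_smul]

/-- The kernel contributes `-⟨v, rκe₁⟩ = rκ v₁`, positive because the form is negative on `e₁`. -/
theorem hasDerivAt_laplace_orbit {X : 𝔤 2} {κ : ℝ} (hκ : X.1 *ᵥ e₀ 2 = κ • Pi.single 1 1)
    {r : ℝ} (hr : 0 < r) (c : ℕ) :
    HasDerivAt (fun s : ℝ => laplace (damp c (π.orbit φ)) (dual (r • (expG (s • X)).mat *ᵥ e₀ 2)))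
      (((r * κ : ℝ) : ℂ) • laplace (damp c fun v => (v 1 : ℂ) • π.orbit φ v) (dual (r • e₀ 2)))
      0 := by
  have hF := (polyGrowth_orbit le_rfl hφ).damp c
  have hmem : dual (r • e₀ 2) ∈ tube 2 := dual_mem_tube (smul_mem_cone e₀_mem_cone hr)
  have h0 : dual (r • (expG ((0 : ℝ) • X)).mat *ᵥ e₀ 2) = dual (r • e₀ 2) := by
    rw [expG_zero_smul, G.mat_one, Matrix.one_mulVec]
  have h1 := hF.hasFDerivAt hmem
  rw [← h0] at h1
  have h2 := (h1.restrictScalars ℝ).comp_hasDerivAt 0 (hasDerivAt_dual_exp hκ r)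
  convert! h2 using 1
  rw [h0]
  change _ = (laplace (derivDensity (damp c (π.orbit φ))) (dual (r • e₀ 2)))
    (dual ((r * κ) • Pi.single 1 1))
  have h3 := laplace_clm_comp hF.derivDensity
    (ContinuousLinearMap.apply ℂ V (dual ((r * κ) • Pi.single 1 1))) hmem
  simp only [ContinuousLinearMap.apply_apply] at h3
  rw [← h3]
  unfold laplace
  rw [← integral_smul]
  refine integral_congr_ae (Filter.Eventually.of_forall fun v => ?_)
  simp only [derivDensity, damp, neg_apply,
    ContinuousLinearMap.smulRight_apply, pairing_dual, lor_two]
  simp only [smul_smul, ← neg_smul]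
  congr 1
  simp
  ring

variable (hπ : π.IsIrreducible) (hφ₀ : φ ≠ 0)
include hπ hφ₀

/-- Differentiate `L_c(r exp(sX) e₀) = C π(exp sX)φ` at `s = 0` and divide by `rκ`. -/
theorem exists_laplace_coord_orbit_eq {X : 𝔤 2} (hX : X ∈ 𝔫 2) (hX0 : X ≠ 0) {r : ℝ} (hr : 0 < r)
    (c : ℕ) : ∃ C : ℂ, laplace (damp c fun v => (v 1 : ℂ) • π.orbit φ v) (dual (r • e₀ 2)) =
      C • π.dop X φ := by
  obtain ⟨κ, hκ0, hκ⟩ := mulVec_e₀_of_mem_𝔫 hX hX0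
  have hd := hasDerivAt_laplace_orbit hφ hκ hr c
  obtain ⟨C, hC⟩ := exists_laplace_orbit_eq le_rfl hφ hπ hφ₀ r c
  simp only [hC] at hd
  have h1 := hd.deriv
  rw [deriv_fun_const_smul_field] at h1
  have hne : ((r * κ : ℝ) : ℂ) ≠ 0 := by exact_mod_cast mul_ne_zero hr.ne' hκ0
  refine ⟨((r * κ : ℝ) : ℂ)⁻¹ * C, ?_⟩
  rw [mul_smul]
  change _ = _ • (C • deriv (fun t : ℝ => π.op (expG (t • X)) φ) 0)
  rw [h1, smul_smul, inv_mul_cancel₀ hne, one_smul]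

theorem exists_dop_eq {X : 𝔤 2} (hX : X ∈ 𝔫 2) (hX0 : X ≠ 0) : ∃ r > (0 : ℝ), ∃ (c : ℕ) (C : ℂ),
    π.dop X φ = C • laplace (damp c fun v => (v 1 : ℂ) • π.orbit φ v) (dual (r • e₀ 2)) := by
  obtain ⟨κ, hκ0, hκ⟩ := mulVec_e₀_of_mem_𝔫 hX hX0
  obtain ⟨r, hr, c, C, hC⟩ := exists_op_eq_smul_laplace le_rfl hφ hπ hφ₀
  have hd := (hasDerivAt_laplace_orbit hφ hκ hr c).const_smul C
  refine ⟨r, hr, c, C * ((r * κ : ℝ) : ℂ), ?_⟩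
  rw [mul_smul, ← hd.deriv, dop]
  congr 1
  ext s
  exact hC _

theorem analyticOnNhd_boost_dop {X : 𝔤 2} (hX : X ∈ 𝔫 2) (hX0 : X ≠ 0) :
    AnalyticOnNhd ℝ (fun t => π.op (boost 2 t) (π.dop X φ)) univ := by
  obtain ⟨r, hr, c, C, h⟩ := exists_dop_eq hφ hπ hφ₀ hX hX0
  simp only [h, map_smul, ← laplace_coord_orbit_boost hφ]
  exact fun t ht => (analyticAt_const (v := C)).smul (analyticOnNhd_laplace_boost two_ne_zero
    ((polyGrowth_coord_orbit hφ).damp c) hr t ht)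

/-- The function `v ↦ ⟨π(a)φ, F(v)⟩`, for `a ∈ A`, depends on Lorentz products only and is even,
since the reflection fixes `a e₀`; `π(boost 2 t)Xφ` is a transform of `v₁F`, so the pairing
integrates an odd function. -/
theorem inner_op_boost_dop {X : 𝔤 2} (hX : X ∈ 𝔫 2) (hX0 : X ≠ 0) (s t : ℝ) :
    ⟪π.op (boost 2 s) φ, π.op (boost 2 t) (π.dop X φ)⟫_ℂ = 0 := by
  obtain ⟨r, hr, c, C, h⟩ := exists_dop_eq hφ hπ hφ₀ hX hX0
  have hfix : ∀ t : ℝ, ((boost 2 t).mat *ᵥ e₀ 2) 1 = 0 := by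
    intro t
    rw [boost_mulVec_e₀ two_ne_zero]
    simp [show Fin.last 2 = (2 : Fin 3) from rfl]
  have hmem : dual (r • (boost 2 t).mat *ᵥ e₀ 2) ∈ tube 2 :=
    dual_mem_tube (smul_mem_cone (mulVec_mem_cone _ e₀_mem_cone) hr)
  have h1 := laplace_damp_clm_comp (polyGrowth_coord_orbit hφ)
    (innerSL ℂ (π.op (boost 2 s) φ)) c hmem
  rw [h, map_smul, inner_smul_right, ← laplace_coord_orbit_boost hφ]
  simp only [innerSL_apply_apply] at h1
  rw [← h1, laplace_damp_eq_zero_of_odd _ c, mul_zero]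
  · rw [Pi.smul_apply, hfix, smul_zero]
  · intro v hv
    have hbs := mulVec_mem_cone (boost 2 s) (e₀_mem_cone (l := 2))
    have hrefl : reflection *ᵥ ((boost 2 s).mat *ᵥ e₀ 2) = (boost 2 s).mat *ᵥ e₀ 2 := by
      rw [reflection_mulVec]
      ext i
      fin_cases i <;> simp [hfix]
    have heven : ⟪π.op (boost 2 s) φ, π.orbit φ (reflection *ᵥ v)⟫_ℂ =
        ⟪π.op (boost 2 s) φ, π.orbit φ v⟫_ℂ := by
      rw [← orbit_mulVec_e₀ hφ, inner_orbit_orbit hφ le_rfl hbs (reflection_mem_cone hv),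
        inner_orbit_orbit hφ le_rfl hbs hv]
      simp only [lor_smul_left, lor_smul_right, lor_reflection v v]
      conv_lhs => rw [← hrefl, lor_reflection, lor_reflection]
    rw [inner_smul_right, inner_smul_right, heven, reflection_mulVec]
    simp

theorem disjoint_envelope {X : 𝔤 2} (hX : X ∈ 𝔫 2) (hX0 : X ≠ 0) :
    Disjoint (π.envelope (𝔞 2) φ) (π.envelope (𝔞 2) (π.dop X φ)) := by
  apply Submodule.IsOrtho.disjoint
  rw [Submodule.isOrtho_iff_le]
  intro u hu
  rw [mem_envelope_orthogonal_iff (analyticOnNhd_boost_dop hφ hπ hφ₀ hX hX0)]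
  intro t
  have h : π.op (boost 2 t) (π.dop X φ) ∈ (π.envelope (𝔞 2) φ)ᗮ := by
    rw [mem_envelope_orthogonal_iff (analyticOnNhd_boost le_rfl hφ hπ hφ₀)]
    intro s
    rw [← inner_conj_symm, inner_op_boost_dop hφ hπ hφ₀ hX hX0, map_zero]
  exact (Submodule.mem_orthogonal _ _).1 h u hu

/-- Orthogonality to `U(𝔞)φ` kills the planar transforms of `f = ⟨w, F⟩`, orthogonality to `U(𝔞)Xφ`
those of `v₁ f`; together they force `f = 0`. -/
theorem topologicalClosure_envelope_sup {X : 𝔤 2} (hX : X ∈ 𝔫 2) (hX0 : X ≠ 0) :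
    (π.envelope (𝔞 2) φ ⊔ π.envelope (𝔞 2) (π.dop X φ)).topologicalClosure = ⊤ := by
  rw [Submodule.topologicalClosure_eq_top_iff, eq_bot_iff]
  intro w hw
  rw [← Submodule.inf_orthogonal, Submodule.mem_inf,
    mem_envelope_orthogonal_iff (analyticOnNhd_boost le_rfl hφ hπ hφ₀),
    mem_envelope_orthogonal_iff (analyticOnNhd_boost_dop hφ hπ hφ₀ hX hX0)] at hw
  refine hπ.eq_zero_of_inner_eq_zero hφ₀ fun g => ?_
  have := eq_zero_of_laplace_eq_zero_two ((polyGrowth_orbit le_rfl hφ).clm_comp (innerSL ℂ w))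
    (fun a b ha hb c => laplace_inner_orbit_planar le_rfl hφ hπ hφ₀ hw.1 ha hb c)
    (fun a b ha hb c => by
      obtain ⟨r, hr, s, h⟩ := planar_eq two_ne_zero ha hb
      obtain ⟨C, hC⟩ := exists_laplace_coord_orbit_eq hφ hπ hφ₀ hX hX0 hr c
      have h1 := laplace_damp_clm_comp (polyGrowth_coord_orbit hφ) (innerSL ℂ w) c
        (dual_mem_tube (smul_mem_cone (mulVec_mem_cone (boost 2 s) e₀_mem_cone) hr))
      simp only [map_smul] at h1
      rw [h, h1, laplace_coord_orbit_boost hφ, hC, map_smul, map_smul, innerSL_apply_apply, hw.2,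
        smul_zero]) (mulVec_mem_cone g e₀_mem_cone)
  simp only [innerSL_apply_apply] at this
  rwa [orbit_mulVec_e₀ hφ] at this

end UnitaryRep

end HypRep

end

/-! ### The theorem -/

theorem mainTheorem9 {V : Type*} [NormedAddCommGroup V] [InnerProductSpace ℂ V] [CompleteSpace V]
    (l : ℕ) (hl : 2 ≤ l) (π : HypRep.UnitaryRep (HypRep.G l) V) (hπ : π.IsIrreducible)
    (φ : V) (hφ₀ : φ ≠ 0) (hφ : φ ∈ π.fixed (HypRep.K l)) :
    π.IsSmooth φ ∧
    (2 < l →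
      (∀ a ∈ HypRep.A l, ∀ v ∈ π.fixed (HypRep.M l), π.op a v ∈ π.fixed (HypRep.M l)) ∧
      (Submodule.span ℂ ((fun a => π.op a φ) '' HypRep.A l)).topologicalClosure =
        π.fixed (HypRep.M l) ∧
      (π.envelope (HypRep.𝔞 l) φ).topologicalClosure = π.fixed (HypRep.M l)) ∧
    (l = 2 →
      π.fixed (HypRep.M l) = ⊤ ∧
      ∀ X ∈ HypRep.𝔫 l, X ≠ 0 →
        Disjoint (π.envelope (HypRep.𝔞 l) φ) (π.envelope (HypRep.𝔞 l) (π.dop X φ)) ∧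
        (π.envelope (HypRep.𝔞 l) φ ⊔ π.envelope (HypRep.𝔞 l) (π.dop X φ)).topologicalClosure =
          π.fixed (HypRep.M l)) := by
  refine ⟨HypRep.UnitaryRep.isSmooth_of_mem_fixed hl hφ hπ hφ₀, fun hl' => ⟨?_, ?_, ?_⟩, ?_⟩
  · intro a ha v hv m hm
    have hc : a * m = m * a := Subgroup.mem_centralizer_iff.1 hm.2 a ha
    rw [← HypRep.UnitaryRep.op_mul_apply, ← hc, HypRep.UnitaryRep.op_mul_apply, hv m hm]
  · exact HypRep.UnitaryRep.topologicalClosure_span_orbit_eq hl hφ hπ hφ₀ hl'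
  · rw [HypRep.UnitaryRep.topologicalClosure_envelope
      (HypRep.UnitaryRep.analyticOnNhd_boost hl hφ hπ hφ₀)]
    exact HypRep.UnitaryRep.topologicalClosure_span_orbit_eq hl hφ hπ hφ₀ hl'
  · rintro rfl
    refine ⟨HypRep.UnitaryRep.fixed_M_two, fun X hX hX0 => ⟨?_, ?_⟩⟩
    · exact HypRep.UnitaryRep.disjoint_envelope hφ hπ hφ₀ hX hX0
    · rw [HypRep.UnitaryRep.topologicalClosure_envelope_sup hφ hπ hφ₀ hX hX0,
        HypRep.UnitaryRep.fixed_M_two]
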